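/- Let $q\in L^1[0,1]$ be real-valued and let $t\in[0,2\pi)$ be fixed. Let $L_t(q)$ be the self-adjoint Sturm–Liouville operator in the complex space $L^2[0,1]$ given by $-y''+q(x)y$ on the domain of all $y\in L^2[0,1]$ such that $y$ and $y'$ are absolutely continuous on $[0,1]$, $-y''+qy\in L^2[0,1]$, and $$y(1)=e^{it}y(0),\qquad y'(1)=e^{it}y'(0).$$ If the first (that is, the smallest) eigenvalue of $L_t(q)$ is not less than $\min\{t^2,(2\pi-t)^2\}$, and the spectrum of $L_t(q)$ contains the set $\{(2n\pi-t)^2 : n=1,2,3,\ldots\}$, then $q=0$ almost everywhere on $[0,1]$. (No further condition is imposed on $q$, including in the antiperiodic case $t=\pi$.) -/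

import Mathlib

open MeasureTheory Set

noncomputable section

namespace QuasiPeriodic

/-- The Hilbert space `L²[0,1]` of complex-valued functions. -/
abbrev L2 : Type := Lp ℂ 2 (volume.restrict (Icc (0 : ℝ) 1))

/-- `y` is a function on `[0,1]` with derivative `u` on `[0,1]` (one-sided at the end points), `u` is
absolutely continuous on `[0,1]` (so `y` is `C¹`, in particular absolutely continuous),
`y(1) = e^{it} y(0)` and `y'(1) = e^{it} y'(0)`, and `-y'' + q y = g` almost everywhere
on `[0,1]`. -/
def Solves (t : ℝ) (q : ℝ → ℝ) (y u g : ℝ → ℂ) : Prop :=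
  (∀ x ∈ Icc (0 : ℝ) 1, HasDerivWithinAt y (u x) (Icc 0 1) x) ∧
  AbsolutelyContinuousOnInterval u 0 1 ∧
  y 1 = Complex.exp (Complex.I * t) * y 0 ∧
  u 1 = Complex.exp (Complex.I * t) * u 0 ∧
  ∀ᵐ x ∂(volume.restrict (Icc (0 : ℝ) 1)), ∃ w : ℂ, HasDerivAt u w x ∧ -w + q x * y x = g x

theorem ac_const_mul {u : ℝ → ℂ} (c : ℂ) (hu : AbsolutelyContinuousOnInterval u 0 1) :
    AbsolutelyContinuousOnInterval (fun x => c * u x) 0 1 := by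
  rw [absolutelyContinuousOnInterval_iff] at hu ⊢
  intro ε hε
  obtain ⟨δ, hδ, h⟩ := hu (ε / (‖c‖ + 1)) (by positivity)
  refine ⟨δ, hδ, fun E hE hlt => ?_⟩
  have h1 := h E hE hlt
  have h2 : ∑ i ∈ Finset.range E.1, dist (c * u (E.2 i).1) (c * u (E.2 i).2)
      = ‖c‖ * ∑ i ∈ Finset.range E.1, dist (u (E.2 i).1) (u (E.2 i).2) := by
    rw [Finset.mul_sum]
    refine Finset.sum_congr rfl fun i _ => ?_
    rw [dist_eq_norm, dist_eq_norm, ← mul_sub, norm_mul]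
  rw [h2]
  have h0 : 0 ≤ ∑ i ∈ Finset.range E.1, dist (u (E.2 i).1) (u (E.2 i).2) :=
    Finset.sum_nonneg fun _ _ => dist_nonneg
  rw [lt_div_iff₀ (by positivity)] at h1
  nlinarith [norm_nonneg c]

/-- The graph of `L_t(q)`: the pairs `(f, g)` of elements of `L²[0,1]` such that `f` has a
representative `y` with `y'` absolutely continuous that satisfies the boundary conditions, and
`g = -y'' + q y`. -/
def graph (t : ℝ) (q : ℝ → ℝ) : Submodule ℂ (L2 × L2) where
  carrier := {p | ∃ y u : ℝ → ℂ,
    Solves t q y u p.2 ∧ p.1 =ᵐ[volume.restrict (Icc (0 : ℝ) 1)] y}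
  zero_mem' := by
    refine ⟨fun _ => 0, fun _ => 0, ⟨fun x _ => hasDerivWithinAt_const _ _ _, ?_, by simp, by simp,
      ?_⟩, Lp.coeFn_zero _ _ _⟩
    · have h : AbsolutelyContinuousOnInterval (fun _ : ℝ => (0 : ℂ)) 0 1 := by
        rw [absolutelyContinuousOnInterval_iff]
        intro ε hε
        exact ⟨1, one_pos, fun E _ _ => by simpa using hε⟩
      exact h
    · filter_upwards [Lp.coeFn_zero ℂ 2 (volume.restrict (Icc (0 : ℝ) 1))] with x hx
      exact ⟨0, hasDerivAt_const _ _, by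
        change _ = ((0 : L2) : ℝ → ℂ) x
        rw [hx]; simp⟩
  add_mem' := by
    rintro ⟨f₁, g₁⟩ ⟨f₂, g₂⟩ ⟨y₁, u₁, ⟨hd₁, ha₁, hb₁, hc₁, he₁⟩, hf₁⟩
      ⟨y₂, u₂, ⟨hd₂, ha₂, hb₂, hc₂, he₂⟩, hf₂⟩
    refine ⟨fun x => y₁ x + y₂ x, fun x => u₁ x + u₂ x,
      ⟨fun x hx => (hd₁ x hx).add (hd₂ x hx), ha₁.fun_add ha₂, ?_, ?_, ?_⟩, ?_⟩
    · simp only [hb₁, hb₂]; ring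
    · simp only [hc₁, hc₂]; ring
    · filter_upwards [he₁, he₂, Lp.coeFn_add g₁ g₂] with x h₁ h₂ h
      obtain ⟨w₁, hw₁, e₁⟩ := h₁
      obtain ⟨w₂, hw₂, e₂⟩ := h₂
      refine ⟨w₁ + w₂, hw₁.add hw₂, ?_⟩
      change _ = ((g₁ + g₂ : L2) : ℝ → ℂ) x
      rw [h, Pi.add_apply, ← e₁, ← e₂]; ring
    · filter_upwards [hf₁, hf₂, Lp.coeFn_add f₁ f₂] with x h₁ h₂ h
      change ((f₁ + f₂ : L2) : ℝ → ℂ) x = _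
      rw [h, Pi.add_apply, h₁, h₂]
  smul_mem' := by
    rintro c ⟨f, g⟩ ⟨y, u, ⟨hd, ha, hb, hc, he⟩, hf⟩
    refine ⟨fun x => c * y x, fun x => c * u x,
      ⟨fun x hx => (hd x hx).const_mul c, ac_const_mul c ha, ?_, ?_, ?_⟩, ?_⟩
    · simp only [hb]; ring
    · simp only [hc]; ring
    · filter_upwards [he, Lp.coeFn_smul c g] with x h₁ h
      obtain ⟨w, hw, e⟩ := h₁
      refine ⟨c * w, hw.const_mul c, ?_⟩
      change _ = ((c • g : L2) : ℝ → ℂ) x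
      rw [h, Pi.smul_apply, smul_eq_mul, ← e]; ring
    · filter_upwards [hf, Lp.coeFn_smul c f] with x h₁ h
      change ((c • f : L2) : ℝ → ℂ) x = _
      rw [h, Pi.smul_apply, smul_eq_mul, h₁]

/-- The graph is single-valued: `-y'' + q y` depends only on the class of `y` in `L²[0,1]`. -/
theorem graph_single_valued (t : ℝ) (q : ℝ → ℝ) :
    ∀ p ∈ graph t q, p.1 = 0 → p.2 = 0 := by
  rintro ⟨f, g⟩ ⟨y, u, ⟨hd, -, -, -, he⟩, hf⟩ hf0
  change f = 0 at hf0
  subst hf0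
  have hcont : ContinuousOn y (Icc 0 1) := fun x hx => (hd x hx).continuousWithinAt
  have hy0 : ∀ᵐ x ∂(volume.restrict (Icc (0 : ℝ) 1)), y x = 0 := by
    filter_upwards [hf, Lp.coeFn_zero ℂ 2 (volume.restrict (Icc (0 : ℝ) 1))] with x h₁ h₂
    rw [← h₁]; exact h₂
  have hy : EqOn y (fun _ => 0) (Icc (0 : ℝ) 1) :=
    Measure.eqOn_Icc_of_ae_eq volume zero_ne_one hy0 hcont continuousOn_const
  have hu : ∀ x ∈ Icc (0 : ℝ) 1, u x = 0 := fun x hx =>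
    ((uniqueDiffOn_Icc zero_lt_one) x hx).eq_deriv _ (hd x hx)
      ((hasDerivWithinAt_const x _ (0 : ℂ)).congr hy (hy hx))
  apply Lp.ext
  refine Filter.EventuallyEq.trans ?_ (Lp.coeFn_zero _ _ _).symm
  have hIoo : ∀ᵐ x ∂(volume.restrict (Icc (0 : ℝ) 1)), x ∈ Ioo (0 : ℝ) 1 := by
    rw [← Measure.restrict_congr_set (Ioo_ae_eq_Icc (μ := volume) (a := (0 : ℝ)) (b := 1))]
    exact ae_restrict_mem measurableSet_Ioo
  filter_upwards [he, hIoo] with x h hx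
  obtain ⟨w, hw, e⟩ := h
  have hw0 : w = 0 := by
    refine hw.unique ((hasDerivAt_const x (0 : ℂ)).congr_of_eventuallyEq ?_)
    filter_upwards [Ioo_mem_nhds hx.1 hx.2] with z hz
    exact hu z (Ioo_subset_Icc_self hz)
  change g x = 0
  rw [← e, hw0, hy (Ioo_subset_Icc_self hx)]
  simp

/-- The Sturm-Liouville operator `L_t(q)`, as an unbounded operator in `L²[0,1]`. -/
def L (t : ℝ) (q : ℝ → ℝ) : L2 →ₗ.[ℂ] L2 := (graph t q).toLinearPMap

theorem L_graph (t : ℝ) (q : ℝ → ℝ) : (L t q).graph = graph t q :=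
  Submodule.toLinearPMap_graph_eq _ (graph_single_valued t q)

/-- The resolvent set of an unbounded operator `A`: all complex `z` for which `A - z`, from the
domain of `A` to the whole space, has a bounded everywhere defined two-sided inverse. -/
def resolventSet (A : L2 →ₗ.[ℂ] L2) : Set ℂ :=
  {z | ∃ R : L2 →L[ℂ] L2,
    (∀ h : L2, ∃ f : A.domain, (f : L2) = R h ∧ A f - z • (f : L2) = h) ∧
    ∀ f : A.domain, R (A f - z • (f : L2)) = f}

/-- The spectrum of an unbounded operator. -/
def spectrum (A : L2 →ₗ.[ℂ] L2) : Set ℂ := (resolventSet A)ᶜ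

/-- The set of real eigenvalues of an unbounded operator (all its eigenvalues, if it is
self-adjoint). -/
def eigenvalues (A : L2 →ₗ.[ℂ] L2) : Set ℝ :=
  {lam | ∃ f : A.domain, (f : L2) ≠ 0 ∧ A f = (lam : ℂ) • (f : L2)}

/-- `lam` is the first (that is, the smallest) eigenvalue of `A`. -/
def IsFirstEigenvalue (A : L2 →ₗ.[ℂ] L2) (lam : ℝ) : Prop := IsLeast (eigenvalues A) lam

end QuasiPeriodic

end

/-!
The eigenfunction of `L_t(q)` for a large eigenvalue `k²` with `e^{ik} = e^{-it}` is close to a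
combination of `e^{ikx}` and `e^{-ikx}`; testing the equation against these waves and using the
Riemann-Lebesgue lemma forces `∫ q = 0`.

Let `τ² = min {t², (2π - t)²}` with `e^{iτ} = e^{it}`. Then `e^{iτx}` satisfies the boundary
conditions and its Rayleigh quotient is `τ² + ∫ q = τ²`, which does not exceed the first eigenvalue.
Hence it minimises the Rayleigh quotient, so it is an eigenfunction, and its equation
`τ² e^{iτx} + q e^{iτx} = τ² e^{iτx}` gives `q = 0`. That a first eigenvalue exists follows from the
compact resolvent `R` at some `-c` below the spectrum: it is positive, and `‖R‖⁻¹ - c` is the first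
eigenvalue.
-/

noncomputable section

open Filter Topology
open scoped ComplexConjugate

namespace QuasiPeriodic

section AbsoluteContinuity

variable {E : Type*} [NormedAddCommGroup E] [NormedSpace ℝ E] {a b : ℝ}

theorem norm_integral_sub_le_abs_integral_norm_sub {h : ℝ → E}
    (hh : IntervalIntegrable h volume a b) {x y : ℝ} (hx : x ∈ uIcc a b) (hy : y ∈ uIcc a b) :
    ‖(∫ s in a..x, h s) - ∫ s in a..y, h s‖ ≤ |(∫ s in a..x, ‖h s‖) - ∫ s in a..y, ‖h s‖| := by
  have hx' := uIcc_subset_uIcc_left hx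
  have hy' := uIcc_subset_uIcc_left hy
  rw [intervalIntegral.integral_interval_sub_left (hh.mono_set hx') (hh.mono_set hy'),
    intervalIntegral.integral_interval_sub_left (hh.norm.mono_set hx') (hh.norm.mono_set hy')]
  exact intervalIntegral.norm_integral_le_abs_integral_norm

theorem absolutelyContinuousOnInterval_of_eq_integral {f f' : ℝ → E}
    (hf' : IntervalIntegrable f' volume a b)
    (h : ∀ x ∈ uIcc a b, f x = f a + ∫ s in a..x, f' s) :
    AbsolutelyContinuousOnInterval f a b := by
  have hnorm := hf'.norm.absolutelyContinuousOnInterval_intervalIntegral (c := a) left_mem_uIcc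
  rw [absolutelyContinuousOnInterval_iff] at hnorm ⊢
  intro ε hε
  obtain ⟨δ, hδ, H⟩ := hnorm ε hε
  refine ⟨δ, hδ, fun P hP hlt => (Finset.sum_le_sum fun i hi => ?_).trans_lt (H P hP hlt)⟩
  rw [h _ (hP.1 i hi).1, h _ (hP.1 i hi).2, dist_add_left, dist_eq_norm, Real.dist_eq]
  exact norm_integral_sub_le_abs_integral_norm_sub hf' (hP.1 i hi).1 (hP.1 i hi).2

theorem absolutelyContinuousOnInterval_integral {h : ℝ → E}
    (hh : IntervalIntegrable h volume a b) :
    AbsolutelyContinuousOnInterval (fun x => ∫ s in a..x, h s) a b :=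
  absolutelyContinuousOnInterval_of_eq_integral hh fun x _ => by
    rw [intervalIntegral.integral_same, zero_add]

theorem eq_add_integral_of_absolutelyContinuousOnInterval [CompleteSpace E] {f f' : ℝ → E}
    (hf : AbsolutelyContinuousOnInterval f a b) (hf' : IntervalIntegrable f' volume a b)
    (hd : ∀ᵐ x, x ∈ uIcc a b → HasDerivAt f (f' x) x) :
    ∀ x ∈ uIcc a b, f x = f a + ∫ s in a..x, f' s := by
  have hderiv : ∀ᵐ x, x ∈ uIcc a b → HasDerivAt (fun x => f x - ∫ s in a..x, f' s) 0 x := by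
    filter_upwards [hd, hf'.ae_hasDerivAt_integral] with x h₁ h₂ hx
    simpa using (h₁ hx).fun_sub (h₂ hx a left_mem_uIcc)
  obtain ⟨C, hC⟩ := (hf.fun_sub
    (absolutelyContinuousOnInterval_integral hf')).const_of_ae_hasDerivAt_zero hderiv
  intro x hx
  have ha := hC a left_mem_uIcc
  rw [intervalIntegral.integral_same, sub_zero] at ha
  rw [ha, ← hC x hx, sub_add_cancel]

theorem hasDerivWithinAt_of_eq_integral [CompleteSpace E] {f f' : ℝ → E}
    (hf' : ContinuousOn f' (Icc a b)) (h : ∀ x ∈ Icc a b, f x = f a + ∫ s in a..x, f' s) {x : ℝ}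
    (hx : x ∈ Icc a b) : HasDerivWithinAt f (f' x) (Icc a b) x := by
  have : Fact (x ∈ Icc a b) := ⟨hx⟩
  have hint : IntervalIntegrable f' volume a x :=
    (hf'.mono (Icc_subset_Icc_right hx.2)).intervalIntegrable_of_Icc hx.1
  have hd := intervalIntegral.integral_hasDerivWithinAt_right (s := Icc a b) (t := Icc a b) hint
    (hf'.stronglyMeasurableAtFilter_nhdsWithin measurableSet_Icc x) (hf' x hx)
  exact (hd.const_add (f a)).congr_of_mem h hx

theorem absolutelyContinuousOnInterval_of_hasDerivWithinAt {f f' : ℝ → E} (hab : a ≤ b)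
    (hd : ∀ x ∈ Icc a b, HasDerivWithinAt f (f' x) (Icc a b) x)
    (hf' : ContinuousOn f' (Icc a b)) : AbsolutelyContinuousOnInterval f a b := by
  obtain ⟨C, hC⟩ := isCompact_Icc.exists_bound_of_continuousOn hf'
  refine LipschitzOnWith.absolutelyContinuousOnInterval (K := C.toNNReal) ?_
  rw [uIcc_of_le hab]
  exact (convex_Icc a b).lipschitzOnWith_of_nnnorm_hasDerivWithin_le hd fun x hx =>
    NNReal.coe_le_coe.1 ((hC x hx).trans (Real.le_coe_toNNReal C))

end AbsoluteContinuity

section UnitInterval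

local notation "μ₀" => volume.restrict (Icc (0 : ℝ) 1)

theorem uIcc_zero_one : uIcc (0 : ℝ) 1 = Icc 0 1 := uIcc_of_le zero_le_one

theorem ae_mem_Ioo_zero_one : ∀ᵐ x ∂μ₀, x ∈ Ioo (0 : ℝ) 1 := by
  rw [← Measure.restrict_congr_set (Ioo_ae_eq_Icc (μ := volume) (a := (0 : ℝ)) (b := 1))]
  exact ae_restrict_mem measurableSet_Ioo

theorem intervalIntegrable_zero_one_iff {E : Type*} [NormedAddCommGroup E] {f : ℝ → E} :
    IntervalIntegrable f volume 0 1 ↔ Integrable f μ₀ :=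
  intervalIntegrable_iff_integrableOn_Icc_of_le zero_le_one

theorem integral_zero_one_eq {E : Type*} [NormedAddCommGroup E] [NormedSpace ℝ E] (f : ℝ → E) :
    ∫ x in (0 : ℝ)..1, f x = ∫ x, f x ∂μ₀ := by
  rw [intervalIntegral.integral_of_le zero_le_one, integral_Icc_eq_integral_Ioc]

theorem intervalIntegrable_ofReal {q : ℝ → ℝ} {a b : ℝ} (hq : IntervalIntegrable q volume a b) :
    IntervalIntegrable (fun x => (q x : ℂ)) volume a b :=
  ⟨Integrable.ofReal hq.1, Integrable.ofReal hq.2⟩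

theorem integral_mul_conj_self_eq_ofReal (f : ℝ → ℂ) (a b : ℝ) :
    ∫ x in a..b, f x * conj (f x) = ((∫ x in a..b, ‖f x‖ ^ 2 : ℝ) : ℂ) := by
  rw [← intervalIntegral.integral_ofReal]
  simp only [Complex.mul_conj, Complex.normSq_eq_norm_sq]

/-- `y` is continuously differentiable on `[0,1]` with derivative `u`, one-sided at the end
points. -/
structure IsC1 (y u : ℝ → ℂ) : Prop where
  hasDerivWithinAt : ∀ x ∈ Icc (0 : ℝ) 1, HasDerivWithinAt y (u x) (Icc 0 1) x
  continuousOn_deriv : ContinuousOn u (Icc 0 1)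

namespace IsC1

variable {y u y' u' : ℝ → ℂ}

theorem continuousOn (h : IsC1 y u) : ContinuousOn y (Icc 0 1) :=
  fun x hx => (h.hasDerivWithinAt x hx).continuousWithinAt

theorem absolutelyContinuousOnInterval (h : IsC1 y u) : AbsolutelyContinuousOnInterval y 0 1 :=
  absolutelyContinuousOnInterval_of_hasDerivWithinAt zero_le_one h.hasDerivWithinAt
    h.continuousOn_deriv

theorem ae_hasDerivAt (h : IsC1 y u) : ∀ᵐ x ∂μ₀, HasDerivAt y (u x) x := by
  filter_upwards [ae_mem_Ioo_zero_one] with x hx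
  exact (h.hasDerivWithinAt x (Ioo_subset_Icc_self hx)).hasDerivAt (Icc_mem_nhds hx.1 hx.2)

theorem star (h : IsC1 y u) : IsC1 (fun x => conj (y x)) (fun x => conj (u x)) :=
  ⟨fun x hx => (h.hasDerivWithinAt x hx).star,
    Complex.continuous_conj.comp_continuousOn h.continuousOn_deriv⟩

theorem sub (h : IsC1 y u) (h' : IsC1 y' u') :
    IsC1 (fun x => y x - y' x) (fun x => u x - u' x) :=
  ⟨fun x hx => (h.hasDerivWithinAt x hx).sub (h'.hasDerivWithinAt x hx),
    h.continuousOn_deriv.sub h'.continuousOn_deriv⟩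

theorem const_mul (c : ℂ) (h : IsC1 y u) : IsC1 (fun x => c * y x) (fun x => c * u x) :=
  ⟨fun x hx => (h.hasDerivWithinAt x hx).const_mul c, h.continuousOn_deriv.const_mul c⟩

theorem intervalIntegrable (h : IsC1 y u) : IntervalIntegrable y volume 0 1 :=
  h.continuousOn.intervalIntegrable_of_Icc zero_le_one

end IsC1

/-- `y` is `C¹` on `[0,1]` with absolutely continuous derivative `u`, whose almost everywhere
derivative is `w`, and `y`, `u` are multiplied by `ω` from `0` to `1`. The quasi-periodic case is
`ω = exp (i t)`. -/
structure HasSecondDeriv (ω : ℂ) (y u w : ℝ → ℂ) : Prop where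
  hasDerivWithinAt : ∀ x ∈ Icc (0 : ℝ) 1, HasDerivWithinAt y (u x) (Icc 0 1) x
  absolutelyContinuousOnInterval_deriv : AbsolutelyContinuousOnInterval u 0 1
  apply_one : y 1 = ω * y 0
  deriv_apply_one : u 1 = ω * u 0
  ae_hasDerivAt_deriv : ∀ᵐ x ∂μ₀, HasDerivAt u (w x) x

namespace HasSecondDeriv

variable {ω : ℂ} {y u w y' u' w' : ℝ → ℂ}

theorem isC1 (h : HasSecondDeriv ω y u w) : IsC1 y u :=
  ⟨h.hasDerivWithinAt, uIcc_zero_one ▸ h.absolutelyContinuousOnInterval_deriv.continuousOn⟩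

theorem congr_ae (h : HasSecondDeriv ω y u w) (hw : w =ᵐ[μ₀] w') : HasSecondDeriv ω y u w' where
  __ := h
  ae_hasDerivAt_deriv := by
    filter_upwards [h.ae_hasDerivAt_deriv, hw] with x h₁ h₂ using h₂ ▸ h₁

theorem of_eq_integral (hw : IntervalIntegrable w volume 0 1)
    (hy : ∀ x ∈ Icc (0 : ℝ) 1, y x = y 0 + ∫ s in (0 : ℝ)..x, u s)
    (hu : ∀ x ∈ Icc (0 : ℝ) 1, u x = u 0 + ∫ s in (0 : ℝ)..x, w s)
    (hy₁ : y 1 = ω * y 0) (hu₁ : u 1 = ω * u 0) : HasSecondDeriv ω y u w := by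
  have hac := absolutelyContinuousOnInterval_of_eq_integral hw (uIcc_zero_one ▸ hu)
  refine ⟨fun x hx => hasDerivWithinAt_of_eq_integral (uIcc_zero_one ▸ hac.continuousOn) hy hx,
    hac, hy₁, hu₁, ?_⟩
  have hint := hw.ae_hasDerivAt_integral
  rw [uIcc_zero_one, ← ae_restrict_iff' measurableSet_Icc] at hint
  filter_upwards [hint, ae_mem_Ioo_zero_one] with x hx hxI
  refine ((hx 0 (left_mem_Icc.2 zero_le_one)).const_add (u 0)).congr_of_eventuallyEq ?_
  filter_upwards [Icc_mem_nhds hxI.1 hxI.2] using hu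

/-- Integration by parts; since `ω * conj ω = 1`, the boundary terms cancel. -/
theorem integral_mul_conj (h : HasSecondDeriv ω y u w) (hω : ‖ω‖ = 1)
    (hw : IntervalIntegrable w volume 0 1) (h' : IsC1 y' u') (h'₁ : y' 1 = ω * y' 0) :
    ∫ x in (0 : ℝ)..1, w x * conj (y' x) = -∫ x in (0 : ℝ)..1, u x * conj (u' x) := by
  have hw' : IntervalIntegrable (fun x => w x * conj (y' x)) volume 0 1 :=
    hw.mul_continuousOn (uIcc_zero_one ▸ h'.star.continuousOn)
  have hu' : IntervalIntegrable (fun x => u x * conj (u' x)) volume 0 1 :=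
    (h.isC1.continuousOn_deriv.mul h'.star.continuousOn_deriv).intervalIntegrable_of_Icc zero_le_one
  have hprod : ∀ᵐ x, x ∈ uIcc (0 : ℝ) 1 →
      HasDerivAt (fun x => u x * conj (y' x)) (w x * conj (y' x) + u x * conj (u' x)) x := by
    rw [uIcc_zero_one, ← ae_restrict_iff' measurableSet_Icc]
    filter_upwards [h.ae_hasDerivAt_deriv, h'.star.ae_hasDerivAt] with x h₁ h₂ using h₁.mul h₂
  have hftc := eq_add_integral_of_absolutelyContinuousOnInterval
    (h.absolutelyContinuousOnInterval_deriv.fun_smul h'.star.absolutelyContinuousOnInterval)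
    (hw'.add hu') hprod 1 right_mem_uIcc
  have hωω : ω * conj ω = 1 := by simp [Complex.mul_conj, Complex.normSq_eq_norm_sq, hω]
  have hboundary : u 1 * conj (y' 1) = u 0 * conj (y' 0) := by
    rw [h.deriv_apply_one, h'₁, map_mul]
    linear_combination u 0 * conj (y' 0) * hωω
  simp only [smul_eq_mul] at hftc
  rw [intervalIntegral.integral_add hw' hu', hboundary] at hftc
  linear_combination -hftc

end HasSecondDeriv

theorem solves_iff_hasSecondDeriv {t : ℝ} {q : ℝ → ℝ} {y u g : ℝ → ℂ} :
    Solves t q y u g ↔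
      HasSecondDeriv (Complex.exp (Complex.I * t)) y u (fun x => q x * y x - g x) := by
  constructor
  · rintro ⟨hy, hu, hb, hb', hae⟩
    refine ⟨hy, hu, hb, hb', hae.mono ?_⟩
    rintro x ⟨w, hw, e⟩
    exact hw.congr_deriv (by linear_combination -e)
  · rintro ⟨hy, hu, hb, hb', hae⟩
    exact ⟨hy, hu, hb, hb', hae.mono fun x hx => ⟨_, hx, by ring⟩⟩

theorem isCompact_setOf_norm_sub_le {X : Type*} [TopologicalSpace X] (Γ : C(X, ℝ)) (M : ℝ) :
    IsCompact {f : C(X, ℂ) | (∀ x, ‖f x‖ ≤ M) ∧ ∀ x y, ‖f x - f y‖ ≤ |Γ x - Γ y|} := by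
  have hcont : ∀ x₀, Tendsto (fun x => |Γ x₀ - Γ x|) (𝓝 x₀) (𝓝 0) := fun x₀ => by
    simpa using ((continuous_const.sub Γ.continuous).abs.tendsto (x := x₀) :
      Tendsto (fun x => |Γ x₀ - Γ x|) _ _)
  refine ArzelaAscoli.isCompact_of_equicontinuous _ ?_ fun x₀ =>
    Metric.equicontinuousAt_of_continuity_modulus _ (hcont x₀) _ (.of_forall fun x f => ?_)
  · have himage : ContinuousMap.toFun ''
          {f : C(X, ℂ) | (∀ x, ‖f x‖ ≤ M) ∧ ∀ x y, ‖f x - f y‖ ≤ |Γ x - Γ y|} =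
        (univ.pi fun _ => Metric.closedBall 0 M) ∩
          {f : X → ℂ | ∀ x y, ‖f x - f y‖ ≤ |Γ x - Γ y|} := by
      ext f
      constructor
      · rintro ⟨g, ⟨hb, hg⟩, rfl⟩
        exact ⟨fun x _ => mem_closedBall_zero_iff.2 (hb x), hg⟩
      · rintro ⟨hb, hf⟩
        refine ⟨⟨f, continuous_iff_continuousAt.2 fun x₀ => ?_⟩,
          ⟨fun x => mem_closedBall_zero_iff.1 (hb x (mem_univ x)), hf⟩, rfl⟩
        refine tendsto_iff_norm_sub_tendsto_zero.2 (squeeze_zero (fun _ => norm_nonneg _)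
          (fun x => ?_) (hcont x₀))
        rw [norm_sub_rev]
        exact hf x₀ x
    rw [himage]
    refine (isCompact_univ_pi fun _ => isCompact_closedBall _ _).inter_right ?_
    simp only [ofPred_forall]
    exact isClosed_iInter fun x => isClosed_iInter fun y =>
      isClosed_le (by fun_prop) continuous_const
  · exact (dist_eq_norm _ _).trans_le (f.2.2 x₀ x)

/-- The inclusion of `C[0,1]` into `Lᵖ[0,1]`. -/
def continuousToLp (p : ENNReal) [Fact (1 ≤ p)] : C(Icc (0 : ℝ) 1, ℂ) →L[ℂ] Lp ℂ p μ₀ :=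
  BoundedContinuousFunction.toLp p μ₀ ℂ ∘L
    BoundedContinuousFunction.compContinuousCLM ℂ ℂ ⟨projIcc 0 1 zero_le_one, continuous_projIcc⟩ ∘L
      (ContinuousMap.linearIsometryBoundedOfCompact (Icc (0 : ℝ) 1) ℂ ℂ :
        C(Icc (0 : ℝ) 1, ℂ) →L[ℂ] BoundedContinuousFunction (Icc (0 : ℝ) 1) ℂ)

theorem coeFn_continuousToLp (p : ENNReal) [Fact (1 ≤ p)] (f : C(Icc (0 : ℝ) 1, ℂ)) :
    continuousToLp p f =ᵐ[μ₀] IccExtend zero_le_one f :=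
  BoundedContinuousFunction.coeFn_toLp p μ₀ ℂ _

theorem uIcc_zero_subset {x : ℝ} (hx : x ∈ Icc (0 : ℝ) 1) : uIcc 0 x ⊆ uIcc (0 : ℝ) 1 :=
  uIcc_subset_uIcc_left (uIcc_zero_one ▸ hx)

theorem integral_zero_eq_of_ae_eq {f g : ℝ → ℂ} (h : f =ᵐ[μ₀] g) {x : ℝ} (hx : x ∈ Icc (0 : ℝ) 1) :
    ∫ s in (0 : ℝ)..x, f s = ∫ s in (0 : ℝ)..x, g s :=
  intervalIntegral.integral_congr_ae_restrict (ae_restrict_of_ae_restrict_of_subset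
    (uIoc_subset_uIcc.trans ((uIcc_zero_subset hx).trans uIcc_zero_one.subset)) h)

theorem intervalIntegrable_coeFn {p : ENNReal} (hp : 1 ≤ p) (g : Lp ℂ p μ₀) :
    IntervalIntegrable g volume 0 1 :=
  intervalIntegrable_zero_one_iff.2 ((Lp.memLp g).integrable hp)

/-- The indefinite integral `x ↦ ∫₀ˣ h`, as an element of `C[0,1]`. -/
def indefiniteIntegral {E : Type*} [NormedAddCommGroup E] [NormedSpace ℝ E] (h : ℝ → E)
    (hh : IntervalIntegrable h volume 0 1) : C(Icc (0 : ℝ) 1, E) where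
  toFun x := ∫ s in (0 : ℝ)..x, h s
  continuous_toFun :=
    (uIcc_zero_one ▸ (absolutelyContinuousOnInterval_integral hh).continuousOn :
      ContinuousOn (fun x => ∫ s in (0 : ℝ)..x, h s) (Icc 0 1)).comp_continuous
        continuous_subtype_val Subtype.prop

/-- The integration operator `h ↦ ∫₀ˣ h`, from `L¹[0,1]` to `C[0,1]`. -/
def primitive : Lp ℂ 1 μ₀ →L[ℂ] C(Icc (0 : ℝ) 1, ℂ) :=
  LinearMap.mkContinuous
    { toFun h := indefiniteIntegral h (intervalIntegrable_coeFn le_rfl h)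
      map_add' h h' := by
        ext x
        exact (integral_zero_eq_of_ae_eq (Lp.coeFn_add h h') x.2).trans
          (intervalIntegral.integral_add
            ((intervalIntegrable_coeFn le_rfl h).mono_set (uIcc_zero_subset x.2))
            ((intervalIntegrable_coeFn le_rfl h').mono_set (uIcc_zero_subset x.2)))
      map_smul' c h := by
        ext x
        exact (integral_zero_eq_of_ae_eq (Lp.coeFn_smul c h) x.2).trans
          (intervalIntegral.integral_smul c _) } 1 fun h => by
    refine (ContinuousMap.norm_le _ (by positivity)).2 fun x => ?_
    refine (intervalIntegral.norm_integral_le_integral_norm x.2.1).trans ?_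
    rw [one_mul, L1.norm_eq_integral_norm, ← integral_zero_one_eq]
    exact intervalIntegral.integral_mono_interval le_rfl x.2.1 x.2.2
      (.of_forall fun _ => norm_nonneg _) (intervalIntegrable_coeFn le_rfl h).norm

theorem primitive_apply (h : Lp ℂ 1 μ₀) (x : Icc (0 : ℝ) 1) :
    primitive h x = ∫ s in (0 : ℝ)..x, h s := rfl

theorem isCompactOperator_primitive_comp {F : Type*} [NormedAddCommGroup F] [NormedSpace ℂ F]
    (A : F →L[ℂ] Lp ℂ 1 μ₀) {G : ℝ → ℝ} (hG : IntervalIntegrable G volume 0 1)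
    (hA : ∀ f, ‖f‖ ≤ 1 → ∀ᵐ x ∂μ₀, ‖A f x‖ ≤ G x) : IsCompactOperator (primitive ∘L A) := by
  refine (isCompactOperator_iff_image_closedBall_subset_compact (primitive ∘L A).toLinearMap
    one_pos).2 ⟨_, isCompact_setOf_norm_sub_le (indefiniteIntegral G hG) ‖primitive ∘L A‖, ?_⟩
  rintro _ ⟨f, hf, rfl⟩
  rw [mem_closedBall_zero_iff] at hf
  refine ⟨fun x => (ContinuousMap.norm_coe_le_norm _ x).trans
    ((primitive ∘L A).unit_le_opNorm f hf), fun x y => ?_⟩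
  have hint := fun x : Icc (0 : ℝ) 1 =>
    (intervalIntegrable_coeFn le_rfl (A f)).mono_set (uIcc_zero_subset x.2)
  have hintG := fun x : Icc (0 : ℝ) 1 => hG.mono_set (uIcc_zero_subset x.2)
  have hsub : uIoc (y : ℝ) x ⊆ Icc 0 1 :=
    uIoc_subset_uIcc.trans (ordConnected_Icc.uIcc_subset y.2 x.2)
  change ‖(∫ s in (0 : ℝ)..x, A f s) - ∫ s in (0 : ℝ)..y, A f s‖ ≤
    |(∫ s in (0 : ℝ)..x, G s) - ∫ s in (0 : ℝ)..y, G s|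
  rw [intervalIntegral.integral_interval_sub_left (hint x) (hint y),
    intervalIntegral.integral_interval_sub_left (hintG x) (hintG y)]
  exact intervalIntegral.norm_integral_le_abs_of_norm_le
    (ae_restrict_of_ae_restrict_of_subset hsub (hA f hf))
    ((hintG y).symm.trans (hintG x))

/-- The operator `y ↦ p y` from `C[0,1]` to `L¹[0,1]`. -/
def mulL1 (p : Lp ℂ 1 μ₀) : C(Icc (0 : ℝ) 1, ℂ) →L[ℂ] Lp ℂ 1 μ₀ :=
  ((ContinuousLinearMap.mul ℂ ℂ).holderL μ₀ ⊤ 1 1).flip p ∘L continuousToLp ⊤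

theorem coeFn_mulL1 (p : Lp ℂ 1 μ₀) (y : C(Icc (0 : ℝ) 1, ℂ)) :
    mulL1 p y =ᵐ[μ₀] fun x => IccExtend zero_le_one y x * p x := by
  filter_upwards [(ContinuousLinearMap.mul ℂ ℂ).coeFn_holder (continuousToLp ⊤ y) p (r := 1),
    coeFn_continuousToLp ⊤ y] with x h₁ h₂
  rw [← h₂]
  exact h₁

/-- The inclusion of `L²[0,1]` into `L¹[0,1]`. -/
def inclL1 : L2 →L[ℂ] Lp ℂ 1 μ₀ :=
  ((ContinuousLinearMap.mul ℂ ℂ).holderL μ₀ 2 2 1).flip (Lp.const 2 μ₀ 1)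

theorem coeFn_inclL1 (g : L2) : inclL1 g =ᵐ[μ₀] g := by
  filter_upwards [(ContinuousLinearMap.mul ℂ ℂ).coeFn_holder g (Lp.const 2 μ₀ 1) (r := 1),
    Lp.coeFn_const (p := 2) (μ := μ₀) (1 : ℂ)] with x h₁ h₂
  refine h₁.trans ?_
  rw [h₂]
  exact mul_one _

theorem isCompactOperator_primitive_comp_mulL1 (p : Lp ℂ 1 μ₀) :
    IsCompactOperator (primitive ∘L mulL1 p) := by
  refine isCompactOperator_primitive_comp _ (intervalIntegrable_coeFn le_rfl p).norm
    fun y hy => ?_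
  filter_upwards [coeFn_mulL1 p y] with x hx
  rw [hx, norm_mul]
  exact mul_le_of_le_one_left (norm_nonneg _) ((y.norm_coe_le_norm _).trans hy)

theorem exists_apply_eq_apply_add_of_isCompactOperator {X : Type*} [NormedAddCommGroup X]
    [NormedSpace ℂ X] [CompleteSpace X] {T : X →L[ℂ] X} (hT : IsCompactOperator T)
    (h : ∀ x, T x = x → x = 0) : ∃ B : X →L[ℂ] X, ∀ x, B x = T (B x) + x := by
  have hmem : (1 : ℂ) ∈ _root_.resolventSet ℂ T := by
    refine (hT.hasEigenvalue_or_mem_resolventSet one_ne_zero).resolve_left fun hev => ?_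
    obtain ⟨x, hx⟩ := hev.exists_hasEigenvector
    exact hx.2 (h x (hx.apply_eq_smul.trans (one_smul ℂ x)))
  rw [spectrum.mem_resolventSet_iff, map_one] at hmem
  obtain ⟨A, hA⟩ := hmem
  refine ⟨(A⁻¹ : (X →L[ℂ] X)ˣ), fun x => ?_⟩
  have hx : (1 - T) ((A⁻¹.1 : X →L[ℂ] X) x) = x := by
    rw [← hA, ← mul_apply_eq_comp, Units.mul_inv, one_apply_eq_self]
  exact sub_eq_iff_eq_add'.1 hx

/-- The operator `f ↦ (1 - ω) f(0) + f(1)` from `C[0,1]` to the constant functions. A function `f`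
whose value at `0` is this constant satisfies `f(1) = ω f(0)`. -/
def boundaryConst (ω : ℂ) : C(Icc (0 : ℝ) 1, ℂ) →L[ℂ] C(Icc (0 : ℝ) 1, ℂ) :=
  ContinuousLinearMap.toSpanSingleton ℂ 1 ∘L
    ((1 - ω) • ContinuousMap.evalCLM ℂ 0 + ContinuousMap.evalCLM ℂ 1)

theorem boundaryConst_apply (ω : ℂ) (f : C(Icc (0 : ℝ) 1, ℂ)) (x : Icc (0 : ℝ) 1) :
    boundaryConst ω f x = (1 - ω) * f 0 + f 1 := by
  simp [boundaryConst]

theorem isCompactOperator_boundaryConst (ω : ℂ) : IsCompactOperator (boundaryConst ω) :=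
  (isCompactOperator_of_locallyCompactSpace_dom
    ((1 - ω) • ContinuousMap.evalCLM ℂ 0 + ContinuousMap.evalCLM ℂ 1)).clm_comp
      (ContinuousLinearMap.toSpanSingleton ℂ (1 : C(Icc (0 : ℝ) 1, ℂ)))

/-- The map `(y, u) ↦ (y(1) + (1 - ω) y(0) + ∫₀ˣ u, u(1) + (1 - ω) u(0) + ∫₀ˣ p y)`, whose fixed
points are the pairs `(y, y')` with `y'' = p y`, `y(1) = ω y(0)` and `y'(1) = ω y'(0)`. -/
def systemMap (ω : ℂ) (p : Lp ℂ 1 μ₀) :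
    C(Icc (0 : ℝ) 1, ℂ) × C(Icc (0 : ℝ) 1, ℂ) →L[ℂ] C(Icc (0 : ℝ) 1, ℂ) × C(Icc (0 : ℝ) 1, ℂ) :=
  (boundaryConst ω).prodMap (boundaryConst ω) +
    ((primitive ∘L mulL1 (Lp.const 1 μ₀ 1)).prodMap (primitive ∘L mulL1 p)) ∘L
      ((ContinuousLinearMap.snd ℂ _ _).prod (ContinuousLinearMap.fst ℂ _ _))

theorem isCompactOperator_prodMap {X Y : Type*} [NormedAddCommGroup X] [NormedSpace ℂ X]
    [NormedAddCommGroup Y] [NormedSpace ℂ Y] {S : X →L[ℂ] X} {T : Y →L[ℂ] Y}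
    (hS : IsCompactOperator S) (hT : IsCompactOperator T) : IsCompactOperator (S.prodMap T) := by
  have hsum : ⇑(S.prodMap T) =
      ⇑(ContinuousLinearMap.inl ℂ X Y) ∘ S ∘ ContinuousLinearMap.fst ℂ X Y +
        ⇑(ContinuousLinearMap.inr ℂ X Y) ∘ T ∘ ContinuousLinearMap.snd ℂ X Y := by
    ext x <;> simp
  rw [hsum]
  exact ((hS.comp_clm _).clm_comp _).add ((hT.comp_clm _).clm_comp _)

theorem isCompactOperator_systemMap (ω : ℂ) (p : Lp ℂ 1 μ₀) :
    IsCompactOperator (systemMap ω p) :=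
  (isCompactOperator_prodMap (isCompactOperator_boundaryConst ω)
    (isCompactOperator_boundaryConst ω)).add
      ((isCompactOperator_prodMap (isCompactOperator_primitive_comp_mulL1 _)
        (isCompactOperator_primitive_comp_mulL1 p)).comp_clm _)

theorem IccExtend_of_eq_boundaryConst_add_primitive {ω : ℂ} {f : C(Icc (0 : ℝ) 1, ℂ)}
    {h : Lp ℂ 1 μ₀} (hf : f = boundaryConst ω f + primitive h) :
    (∀ x ∈ Icc (0 : ℝ) 1, IccExtend zero_le_one f x =
      IccExtend zero_le_one f 0 + ∫ s in (0 : ℝ)..x, h s) ∧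
    IccExtend zero_le_one f 1 = ω * IccExtend zero_le_one f 0 := by
  have happly (x : Icc (0 : ℝ) 1) : f x = (1 - ω) * f 0 + f 1 + ∫ s in (0 : ℝ)..x, h s := by
    rw [← boundaryConst_apply ω f x, ← primitive_apply, ← ContinuousMap.add_apply, ← hf]
  have h₁ : f 1 = ω * f 0 := by
    have h₀ := happly 0
    rw [Icc.coe_zero, intervalIntegral.integral_same] at h₀
    linear_combination -h₀
  refine ⟨fun x hx => ?_, by rw [IccExtend_left, IccExtend_right]; exact h₁⟩
  rw [IccExtend_of_mem zero_le_one f hx, IccExtend_left]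
  exact (happly ⟨x, hx⟩).trans (by linear_combination h₁)

theorem hasSecondDeriv_of_eq_systemMap {ω : ℂ} {p h : Lp ℂ 1 μ₀} {y u : C(Icc (0 : ℝ) 1, ℂ)}
    (hyu : (y, u) = systemMap ω p (y, u) - (0, primitive h)) :
    HasSecondDeriv ω (IccExtend zero_le_one y) (IccExtend zero_le_one u)
      (fun x => p x * IccExtend zero_le_one y x - h x) := by
  have hfst : y = boundaryConst ω y + primitive (mulL1 (Lp.const 1 μ₀ 1) u) :=
    (congrArg Prod.fst hyu).trans (sub_zero _)
  have hsnd : u = boundaryConst ω u + primitive (mulL1 p y - h) := by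
    rw [map_sub, ← add_sub_assoc]
    exact congrArg Prod.snd hyu
  have hu : mulL1 (Lp.const 1 μ₀ 1) u =ᵐ[μ₀] IccExtend zero_le_one u := by
    filter_upwards [coeFn_mulL1 (Lp.const 1 μ₀ 1) u, Lp.coeFn_const (p := 1) (μ := μ₀) (1 : ℂ)]
      with s h₁ h₂
    rw [h₁, h₂, Function.const_apply, mul_one]
  have hw : ⇑(mulL1 p y - h) =ᵐ[μ₀] fun s => p s * IccExtend zero_le_one y s - h s := by
    filter_upwards [Lp.coeFn_sub (mulL1 p y) h, coeFn_mulL1 p y] with s h₁ h₂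
    rw [h₁, Pi.sub_apply, h₂, mul_comm]
  obtain ⟨hy, hy₁⟩ := IccExtend_of_eq_boundaryConst_add_primitive hfst
  obtain ⟨hu', hu₁⟩ := IccExtend_of_eq_boundaryConst_add_primitive hsnd
  exact (HasSecondDeriv.of_eq_integral (intervalIntegrable_coeFn le_rfl _)
    (fun x hx => by rw [hy x hx, integral_zero_eq_of_ae_eq hu hx]) hu' hy₁ hu₁).congr_ae hw

theorem mem_graph_continuousToLp {q : ℝ → ℝ} {t : ℝ} {z : ℂ} {p : Lp ℂ 1 μ₀}
    (hp : p =ᵐ[μ₀] fun x => q x - z) {y u : C(Icc (0 : ℝ) 1, ℂ)} {g : L2}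
    (hyu : (y, u) =
      systemMap (Complex.exp (Complex.I * t)) p (y, u) - (0, primitive (inclL1 g))) :
    (continuousToLp 2 y, g + z • continuousToLp 2 y) ∈ graph t q := by
  refine ⟨IccExtend zero_le_one y, IccExtend zero_le_one u,
    solves_iff_hasSecondDeriv.2 ((hasSecondDeriv_of_eq_systemMap hyu).congr_ae ?_),
    coeFn_continuousToLp 2 y⟩
  filter_upwards [hp, coeFn_inclL1 g, coeFn_continuousToLp 2 y,
    Lp.coeFn_add g (z • continuousToLp 2 y), Lp.coeFn_smul z (continuousToLp 2 y)]
    with x h₁ h₂ h₃ h₄ h₅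
  rw [h₁, h₂, h₄, Pi.add_apply, h₅, Pi.smul_apply, h₃, smul_eq_mul]
  ring

theorem continuousToLp_injective (r : ENNReal) [Fact (1 ≤ r)] :
    Function.Injective (continuousToLp r) := by
  intro y y' h
  have hae : IccExtend zero_le_one y =ᵐ[μ₀] IccExtend zero_le_one y' :=
    (coeFn_continuousToLp r y).symm.trans (h ▸ coeFn_continuousToLp r y')
  ext x
  have hx := Measure.eqOn_Icc_of_ae_eq volume zero_ne_one hae
    y.continuous.Icc_extend'.continuousOn y'.continuous.Icc_extend'.continuousOn x.2
  rwa [IccExtend_of_mem zero_le_one _ x.2, IccExtend_of_mem zero_le_one _ x.2] at hx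

theorem eq_zero_of_systemMap_eq {q : ℝ → ℝ} {t : ℝ} {z : ℂ}
    (hz : ∀ f : L2, (f, z • f) ∈ graph t q → f = 0) {p : Lp ℂ 1 μ₀}
    (hp : p =ᵐ[μ₀] fun x => q x - z) {y u : C(Icc (0 : ℝ) 1, ℂ)}
    (hyu : systemMap (Complex.exp (Complex.I * t)) p (y, u) = (y, u)) : (y, u) = 0 := by
  have hyu' : (y, u) = systemMap (Complex.exp (Complex.I * t)) p (y, u) -
      (0, primitive (inclL1 0)) := by
    simp [hyu]
  obtain rfl : y = 0 := by
    refine continuousToLp_injective 2 ((hz _ ?_).trans (map_zero _).symm)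
    simpa only [zero_add] using mem_graph_continuousToLp hp hyu'
  refine Prod.ext rfl (ContinuousMap.ext fun x => ?_)
  have hderiv := (hasSecondDeriv_of_eq_systemMap hyu').hasDerivWithinAt x x.2
  rw [IccExtend_of_mem zero_le_one _ x.2] at hderiv
  exact (uniqueDiffOn_Icc zero_lt_one x x.2).eq_deriv _ hderiv (hasDerivWithinAt_const _ _ 0)

theorem exists_resolvent {q : ℝ → ℝ} (hq : IntervalIntegrable q volume 0 1) {t : ℝ} {z : ℂ}
    (hz : ∀ f : L2, (f, z • f) ∈ graph t q → f = 0) :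
    ∃ R : L2 →L[ℂ] L2, IsCompactOperator R ∧ ∀ g, (R g, g + z • R g) ∈ graph t q := by
  have hp : Integrable (fun x => (q x - z : ℂ)) μ₀ := intervalIntegrable_zero_one_iff.1
    ((intervalIntegrable_ofReal hq).sub intervalIntegrable_const)
  set K := systemMap (Complex.exp (Complex.I * t)) (hp.toL1 _)
  have hKc : IsCompactOperator K := isCompactOperator_systemMap _ _
  obtain ⟨B, hB⟩ := exists_apply_eq_apply_add_of_isCompactOperator hKc
    fun _ => eq_zero_of_systemMap_eq hz hp.coeFn_toL1
  let S := ContinuousLinearMap.inr ℂ C(Icc (0 : ℝ) 1, ℂ) _ ∘L (-(primitive ∘L inclL1))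
  let fst := ContinuousLinearMap.fst ℂ C(Icc (0 : ℝ) 1, ℂ) C(Icc (0 : ℝ) 1, ℂ)
  have hfst : ∀ g, (K (B (S g))).1 = (B (S g)).1 := fun g => by
    conv_rhs => rw [hB]
    exact (add_zero _).symm
  refine ⟨continuousToLp 2 ∘L fst ∘L K ∘L B ∘L S,
    ((hKc.comp_clm (B ∘L S)).clm_comp fst).clm_comp (continuousToLp 2), fun g => ?_⟩
  change (continuousToLp 2 (K (B (S g))).1, g + z • continuousToLp 2 (K (B (S g))).1) ∈ _
  rw [hfst]
  refine mem_graph_continuousToLp (u := (B (S g)).2) hp.coeFn_toL1 ((hB (S g)).trans ?_)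
  rw [sub_eq_add_neg, Prod.neg_mk, neg_zero]
  rfl

theorem apply_sub_smul_eq_of_mem {E : Type*} [NormedAddCommGroup E] [NormedSpace ℂ E]
    {G : Submodule ℂ (E × E)} {z : ℂ} (hz : ∀ f : E, (f, z • f) ∈ G → f = 0) {R : E →L[ℂ] E}
    (hR : ∀ g, (R g, g + z • R g) ∈ G) {f g : E} (hfg : (f, g) ∈ G) : R (g - z • f) = f := by
  refine sub_eq_zero.1 (hz _ ?_)
  convert G.sub_mem (hR (g - z • f)) hfg using 1
  rw [Prod.mk_sub_mk]
  congr 1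
  module

theorem mem_resolventSet_of_mem_graph {A : L2 →ₗ.[ℂ] L2} {z : ℂ}
    (hz : ∀ f : L2, (f, z • f) ∈ A.graph → f = 0) {R : L2 →L[ℂ] L2}
    (hR : ∀ g, (R g, g + z • R g) ∈ A.graph) : z ∈ resolventSet A := by
  refine ⟨R, fun g => ?_, fun f => apply_sub_smul_eq_of_mem hz hR (A.mem_graph f)⟩
  obtain ⟨f, hf, hAf⟩ := A.mem_graph_iff.1 (hR g)
  exact ⟨f, hf, by rw [hAf, hf, add_sub_cancel_right]⟩

theorem exists_mem_graph_of_mem_spectrum {q : ℝ → ℝ} (hq : IntervalIntegrable q volume 0 1) {t : ℝ}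
    {z : ℂ} (hz : z ∈ spectrum (L t q)) : ∃ f : L2, f ≠ 0 ∧ (f, z • f) ∈ graph t q := by
  by_contra! hcon
  have hinj : ∀ f : L2, (f, z • f) ∈ graph t q → f = 0 := fun f hf =>
    by_contra fun hf0 => hcon f hf0 hf
  obtain ⟨R, -, hR⟩ := exists_resolvent hq hinj
  rw [← L_graph] at hinj hR
  exact hz (mem_resolventSet_of_mem_graph hinj hR)

theorem apply_le_integral_add_integral_abs_deriv {φ φ' : ℝ → ℝ}
    (hd : ∀ x ∈ Icc (0 : ℝ) 1, HasDerivWithinAt φ (φ' x) (Icc 0 1) x)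
    (hφ' : ContinuousOn φ' (Icc 0 1)) {x : ℝ} (hx : x ∈ Icc (0 : ℝ) 1) :
    φ x ≤ (∫ s in (0 : ℝ)..1, φ s) + ∫ s in (0 : ℝ)..1, |φ' s| := by
  have hφ : IntervalIntegrable φ volume 0 1 := ContinuousOn.intervalIntegrable_of_Icc zero_le_one
    fun s hs => (hd s hs).continuousWithinAt
  have hosc : ∀ s ∈ Icc (0 : ℝ) 1, φ x ≤ φ s + ∫ r in (0 : ℝ)..1, |φ' r| := by
    intro s hs
    have hsub : uIcc s x ⊆ Icc (0 : ℝ) 1 := ordConnected_Icc.uIcc_subset hs hx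
    have hftc : ∫ r in s..x, φ' r = φ x - φ s :=
      intervalIntegral.integral_eq_sub_of_hasDeriv_right
        (fun r hr => (hd r (hsub hr)).continuousWithinAt.mono hsub)
        (fun r hr => ((hd r (hsub (Ioo_subset_Icc_self hr))).hasDerivAt
          (mem_of_superset (Icc_mem_nhds hr.1 hr.2) hsub)).hasDerivWithinAt)
        (hφ'.mono hsub).intervalIntegrable
    have hle : ‖∫ r in s..x, φ' r‖ ≤ ∫ r in (0 : ℝ)..1, |φ' r| := by
      rw [integral_zero_one_eq]
      exact intervalIntegral.norm_integral_le_integral_norm_uIoc.trans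
        (setIntegral_mono_set hφ'.norm.integrableOn_Icc (ae_of_all _ fun _ => norm_nonneg _)
          (uIoc_subset_uIcc.trans hsub).eventuallyLE)
    rw [hftc] at hle
    linarith [le_of_abs_le hle]
  have hmono := intervalIntegral.integral_mono_on zero_le_one
    (intervalIntegrable_const (μ := volume)) (hφ.add intervalIntegrable_const) hosc
  rw [intervalIntegral.integral_add hφ intervalIntegrable_const] at hmono
  simpa only [intervalIntegral.integral_const, sub_zero, one_smul] using hmono

theorem IsC1.mul_norm_sq_le {y u : ℝ → ℂ} (h : IsC1 y u) {K : ℝ} (hK : 0 ≤ K) {x : ℝ}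
    (hx : x ∈ Icc (0 : ℝ) 1) :
    K * ‖y x‖ ^ 2 ≤
      (K + K ^ 2) * (∫ s in (0 : ℝ)..1, ‖y s‖ ^ 2) + ∫ s in (0 : ℝ)..1, ‖u s‖ ^ 2 := by
  have hy : IntervalIntegrable (fun s => ‖y s‖ ^ 2) volume 0 1 :=
    (h.continuousOn.norm.pow 2).intervalIntegrable_of_Icc zero_le_one
  have hu : IntervalIntegrable (fun s => ‖u s‖ ^ 2) volume 0 1 :=
    (h.continuousOn_deriv.norm.pow 2).intervalIntegrable_of_Icc zero_le_one
  have hd : ContinuousOn (fun s => K * (2 * inner ℝ (y s) (u s))) (Icc 0 1) :=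
    continuousOn_const.mul (continuousOn_const.mul (h.continuousOn.inner h.continuousOn_deriv))
  have hsup := apply_le_integral_add_integral_abs_deriv
    (fun s hs => ((h.hasDerivWithinAt s hs).norm_sq).const_mul K) hd hx
  have hcross : ∫ s in (0 : ℝ)..1, |K * (2 * inner ℝ (y s) (u s))| ≤
      ∫ s in (0 : ℝ)..1, (K ^ 2 * ‖y s‖ ^ 2 + ‖u s‖ ^ 2) := by
    refine intervalIntegral.integral_mono_on zero_le_one
      (hd.abs.intervalIntegrable_of_Icc zero_le_one) ((hy.const_mul _).add hu) fun s _ => ?_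
    rw [abs_mul, abs_mul, abs_two, abs_of_nonneg hK]
    nlinarith [mul_le_mul_of_nonneg_left (abs_real_inner_le_norm (y s) (u s)) hK,
      sq_nonneg (K * ‖y s‖ - ‖u s‖)]
  rw [intervalIntegral.integral_add (hy.const_mul _) hu, intervalIntegral.integral_const_mul]
    at hcross
  rw [intervalIntegral.integral_const_mul] at hsup
  linarith

/-- The sesquilinear form of `-y'' + (q + c) y`, linear in `(y, u)`, where `u` and `u'` stand for
the derivatives of `y` and `y'`. -/
def energyInner (q : ℝ → ℝ) (c : ℝ) (y u y' u' : ℝ → ℂ) : ℂ :=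
  ∫ x in (0 : ℝ)..1, (u x * conj (u' x) + (q x + c) * (y x * conj (y' x)))

/-- The quadratic form `∫ |y'|² + (q + c) |y|²` of `-y'' + (q + c) y`, where `u` stands for `y'`. -/
def energy (q : ℝ → ℝ) (c : ℝ) (y u : ℝ → ℂ) : ℝ :=
  ∫ x in (0 : ℝ)..1, (‖u x‖ ^ 2 + (q x + c) * ‖y x‖ ^ 2)

theorem energyInner_self (q : ℝ → ℝ) (c : ℝ) (y u : ℝ → ℂ) :
    energyInner q c y u y u = energy q c y u := by
  rw [energyInner, energy, ← intervalIntegral.integral_ofReal]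
  simp only [Complex.mul_conj', Complex.ofReal_add, Complex.ofReal_mul, Complex.ofReal_pow]

section Energy

variable {q : ℝ → ℝ} {c : ℝ} {y u y' u' : ℝ → ℂ}

theorem intervalIntegrable_energyInner (hq : IntervalIntegrable q volume 0 1) (h : IsC1 y u)
    (h' : IsC1 y' u') :
    IntervalIntegrable (fun x => u x * conj (u' x) + (q x + c) * (y x * conj (y' x)))
      volume 0 1 :=
  ((h.continuousOn_deriv.mul h'.star.continuousOn_deriv).intervalIntegrable_of_Icc
    zero_le_one).add (((intervalIntegrable_ofReal hq).add intervalIntegrable_const).mul_continuousOn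
      (uIcc_zero_one ▸ h.continuousOn.mul h'.star.continuousOn))

theorem intervalIntegrable_energy (hq : IntervalIntegrable q volume 0 1) (h : IsC1 y u) :
    IntervalIntegrable (fun x => ‖u x‖ ^ 2 + (q x + c) * ‖y x‖ ^ 2) volume 0 1 :=
  ((h.continuousOn_deriv.norm.pow 2).intervalIntegrable_of_Icc zero_le_one).add
    ((hq.add intervalIntegrable_const).mul_continuousOn
      (uIcc_zero_one ▸ h.continuousOn.norm.pow 2))

theorem energy_eq_add (hq : IntervalIntegrable q volume 0 1) (h : IsC1 y u) :
    energy q c y u = (∫ x in (0 : ℝ)..1, ‖u x‖ ^ 2) + (∫ x in (0 : ℝ)..1, q x * ‖y x‖ ^ 2) +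
      c * ∫ x in (0 : ℝ)..1, ‖y x‖ ^ 2 := by
  have hy : ContinuousOn (fun x => ‖y x‖ ^ 2) (Icc 0 1) := h.continuousOn.norm.pow 2
  have hu : IntervalIntegrable (fun x => ‖u x‖ ^ 2) volume 0 1 :=
    (h.continuousOn_deriv.norm.pow 2).intervalIntegrable_of_Icc zero_le_one
  have hqy : IntervalIntegrable (fun x => q x * ‖y x‖ ^ 2) volume 0 1 :=
    hq.mul_continuousOn (uIcc_zero_one ▸ hy)
  rw [← intervalIntegral.integral_const_mul, ← intervalIntegral.integral_add hu hqy,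
    ← intervalIntegral.integral_add (hu.add hqy)
      ((hy.intervalIntegrable_of_Icc zero_le_one).const_mul c), energy]
  simp only [add_mul, add_assoc]

theorem energy_const_mul_sub (hq : IntervalIntegrable q volume 0 1) (h : IsC1 y u)
    (h' : IsC1 y' u') (s : ℝ) :
    energy q c (fun x => s * y x - y' x) (fun x => s * u x - u' x) =
      energy q c y u * s ^ 2 - 2 * s * (energyInner q c y u y' u').re + energy q c y' u' := by
  have hcross := intervalIntegrable_energyInner (c := c) hq h h'
  have hre : (energyInner q c y u y' u').re =
      ∫ x in (0 : ℝ)..1, (u x * conj (u' x) + (q x + c) * (y x * conj (y' x))).re :=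
    (Complex.reCLM.intervalIntegral_comp_comm hcross).symm
  have hcross' : IntervalIntegrable (fun x => (u x * conj (u' x) +
      (q x + c) * (y x * conj (y' x))).re) volume 0 1 :=
    ⟨Complex.reCLM.integrable_comp hcross.1, Complex.reCLM.integrable_comp hcross.2⟩
  have hy := intervalIntegrable_energy (c := c) hq h
  rw [hre, energy, energy, energy, ← intervalIntegral.integral_mul_const,
    ← intervalIntegral.integral_const_mul, ← intervalIntegral.integral_sub (hy.mul_const _)
      (hcross'.const_mul _), ← intervalIntegral.integral_add ((hy.mul_const _).sub
        (hcross'.const_mul _)) (intervalIntegrable_energy hq h')]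
  refine intervalIntegral.integral_congr fun x _ => ?_
  simp only [← Complex.normSq_eq_norm_sq, Complex.normSq_apply, Complex.add_re, Complex.sub_re,
    Complex.sub_im, Complex.mul_re, Complex.mul_im, Complex.conj_re, Complex.conj_im,
    Complex.ofReal_re, Complex.ofReal_im, Complex.add_im]
  ring

theorem sq_re_energyInner_le (hq : IntervalIntegrable q volume 0 1)
    (hpos : ∀ y u : ℝ → ℂ, IsC1 y u → 0 ≤ energy q c y u) (h : IsC1 y u) (h' : IsC1 y' u') :
    (energyInner q c y u y' u').re ^ 2 ≤ energy q c y u * energy q c y' u' := by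
  have hdiscrim := discrim_le_zero (a := energy q c y u) (b := -2 * (energyInner q c y u y' u').re)
    (c := energy q c y' u') fun s => by
      have := hpos _ _ ((h.const_mul s).sub h')
      rw [energy_const_mul_sub hq h h'] at this
      linarith
  rw [discrim] at hdiscrim
  linarith

theorem neg_integral_abs_mul_le_mul_integral (hq : IntervalIntegrable q volume 0 1) (h : IsC1 y u)
    {K B : ℝ} (hK : 0 ≤ K) (hB : ∀ x ∈ Icc (0 : ℝ) 1, K * ‖y x‖ ^ 2 ≤ B) :
    -((∫ x in (0 : ℝ)..1, |q x|) * B) ≤ K * ∫ x in (0 : ℝ)..1, q x * ‖y x‖ ^ 2 := by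
  rw [← intervalIntegral.integral_mul_const, ← intervalIntegral.integral_neg,
    ← intervalIntegral.integral_const_mul]
  refine intervalIntegral.integral_mono_on zero_le_one (hq.norm.mul_const _).neg
    ((hq.mul_continuousOn (uIcc_zero_one ▸ h.continuousOn.norm.pow 2)).const_mul _) fun x hx => ?_
  calc -(|q x| * B) ≤ -(|q x| * (K * ‖y x‖ ^ 2)) := by gcongr; exact hB x hx
    _ = -|q x| * (K * ‖y x‖ ^ 2) := by ring
    _ ≤ q x * (K * ‖y x‖ ^ 2) := by gcongr; exact neg_abs_le _
    _ = K * (q x * ‖y x‖ ^ 2) := by ring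

theorem exists_integral_norm_sq_le_energy (hq : IntervalIntegrable q volume 0 1) :
    ∃ c : ℝ, ∀ y u : ℝ → ℂ, IsC1 y u → ∫ x in (0 : ℝ)..1, ‖y x‖ ^ 2 ≤ energy q c y u := by
  set N : ℝ := ∫ x in (0 : ℝ)..1, |q x|
  have hN : 0 ≤ N := intervalIntegral.integral_nonneg zero_le_one fun x _ => abs_nonneg _
  refine ⟨N * (N + 2) + 1, fun y u h => ?_⟩
  have hpot := neg_integral_abs_mul_le_mul_integral hq h (by positivity)
    fun x hx => h.mul_norm_sq_le (K := N + 1) (by positivity) hx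
  have hu : 0 ≤ ∫ x in (0 : ℝ)..1, ‖u x‖ ^ 2 :=
    intervalIntegral.integral_nonneg zero_le_one fun x _ => by positivity
  rw [energy_eq_add hq h]
  refine le_of_mul_le_mul_left ?_ (show 0 < N + 1 by positivity)
  linarith

theorem HasSecondDeriv.integral_mul_conj_eq_energyInner {ω : ℂ} {g : ℝ → ℂ}
    (hq : IntervalIntegrable q volume 0 1) (hω : ‖ω‖ = 1)
    (h : HasSecondDeriv ω y u (fun x => q x * y x - (g x - c * y x)))
    (hg : IntervalIntegrable g volume 0 1) (h' : IsC1 y' u') (h'₁ : y' 1 = ω * y' 0) :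
    ∫ x in (0 : ℝ)..1, g x * conj (y' x) = energyInner q c y u y' u' := by
  have hy : ContinuousOn y (uIcc 0 1) := uIcc_zero_one ▸ h.isC1.continuousOn
  have hy' : ContinuousOn (fun x => conj (y' x)) (uIcc 0 1) :=
    uIcc_zero_one ▸ h'.star.continuousOn
  have hqyy : IntervalIntegrable (fun x => (q x + c) * (y x * conj (y' x))) volume 0 1 :=
    ((intervalIntegrable_ofReal hq).add intervalIntegrable_const).mul_continuousOn (hy.mul hy')
  have hw : IntervalIntegrable (fun x => q x * y x - (g x - c * y x)) volume 0 1 :=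
    ((intervalIntegrable_ofReal hq).mul_continuousOn hy).sub
      (hg.sub (h.isC1.intervalIntegrable.const_mul _))
  have hu : IntervalIntegrable (fun x => u x * conj (u' x)) volume 0 1 :=
    (h.isC1.continuousOn_deriv.mul h'.star.continuousOn_deriv).intervalIntegrable_of_Icc zero_le_one
  rw [energyInner, intervalIntegral.integral_add hu hqyy,
    ← sub_eq_iff_eq_add', ← neg_eq_iff_eq_neg.2 (h.integral_mul_conj hω hw h' h'₁),
    sub_neg_eq_add, ← intervalIntegral.integral_add (hg.mul_continuousOn hy')
      (hw.mul_continuousOn hy')]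
  refine intervalIntegral.integral_congr fun x _ => ?_
  ring

end Energy

section InnerProduct

variable {f g : L2} {y y' : ℝ → ℂ}

theorem inner_eq_integral_mul_conj (hf : f =ᵐ[μ₀] y) (hg : g =ᵐ[μ₀] y') :
    inner ℂ f g = ∫ x in (0 : ℝ)..1, y' x * conj (y x) := by
  rw [L2.inner_def, integral_zero_one_eq]
  refine integral_congr_ae ?_
  filter_upwards [hf, hg] with x h₁ h₂
  rw [RCLike.inner_apply, h₁, h₂]

theorem integral_norm_sq_eq_norm_sq (hf : f =ᵐ[μ₀] y) :
    ∫ x in (0 : ℝ)..1, ‖y x‖ ^ 2 = ‖f‖ ^ 2 := by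
  have h := inner_eq_integral_mul_conj hf hf
  rw [inner_self_eq_norm_sq_to_K, integral_mul_conj_self_eq_ofReal] at h
  exact Complex.ofReal_injective (h.symm.trans (Complex.ofReal_pow _ _).symm)

end InnerProduct

section CompactPositive

variable {E : Type*} [NormedAddCommGroup E] [InnerProductSpace ℂ E] {R : E →L[ℂ] E}

theorem exists_apply_eq_norm_smul [CompleteSpace E] (hc : IsCompactOperator R)
    (hR : R.IsPositive) (hne : R ≠ 0) : ∃ v : E, v ≠ 0 ∧ R v = (‖R‖ : ℂ) • v := by
  have : Nontrivial (E →L[ℂ] E) := ⟨R, 0, hne⟩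
  have hspec : (‖R‖ : ℂ) ∈ _root_.spectrum ℂ R :=
    (spectrum.algebraMap_mem_iff ℂ).2 (CStarAlgebra.norm_mem_spectrum_of_nonneg
      ((ContinuousLinearMap.nonneg_iff_isPositive R).2 hR))
  have hne' : (‖R‖ : ℂ) ≠ 0 := Complex.ofReal_ne_zero.2 (norm_ne_zero_iff.2 hne)
  obtain ⟨v, hv⟩ := ((hc.hasEigenvalue_iff_mem_spectrum hne').2 hspec).exists_hasEigenvector
  exact ⟨v, hv.2, hv.apply_eq_smul⟩

theorem apply_eq_inv_smul_of_norm_le {F : E} {α : ℝ} (hα : 0 < α) (hF : ‖F‖ = 1)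
    (hR : ‖R‖ ≤ α⁻¹) (hαF : 1 ≤ (inner ℂ (R F) F).re * α) : R F = (α⁻¹ : ℂ) • F := by
  have hRF : ‖R F‖ ^ 2 ≤ α⁻¹ ^ 2 := by
    gcongr
    exact (R.le_opNorm F).trans (by rwa [hF, mul_one])
  have hF' : ‖(α⁻¹ : ℂ) • F‖ = α⁻¹ := by
    rw [norm_smul, hF, mul_one, norm_inv, Complex.norm_of_nonneg hα.le]
  have hcross : RCLike.re (inner ℂ (R F) ((α⁻¹ : ℂ) • F)) = α⁻¹ * (inner ℂ (R F) F).re := by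
    rw [inner_smul_right, ← Complex.ofReal_inv]
    exact Complex.re_ofReal_mul _ _
  have hle : α⁻¹ * α⁻¹ ≤ α⁻¹ * (inner ℂ (R F) F).re := by
    gcongr
    exact (inv_le_iff_one_le_mul₀ hα).2 hαF
  have hsub := norm_sub_sq (𝕜 := ℂ) (R F) ((α⁻¹ : ℂ) • F)
  rw [hF', hcross] at hsub
  refine sub_eq_zero.1 (norm_eq_zero.1 (pow_eq_zero_iff two_ne_zero |>.1 ?_))
  nlinarith [sq_nonneg ‖R F - (α⁻¹ : ℂ) • F‖]

theorem inv_norm_le_of_smul_apply_eq (hR : R.IsPositive) {f : E} (hf : f ≠ 0) {μ : ℝ}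
    (h : (μ : ℂ) • R f = f) : ‖R‖⁻¹ ≤ μ := by
  have hf' : 0 < ‖f‖ := norm_pos_iff.2 hf
  have hμ : 0 < μ := by
    have hnorm : μ * (inner ℂ (R f) f).re = ‖f‖ ^ 2 := by
      rw [← Complex.re_ofReal_mul, ← Complex.conj_ofReal, ← inner_smul_left, h]
      exact inner_self_eq_norm_sq (𝕜 := ℂ) f
    exact pos_of_mul_pos_left (hnorm ▸ pow_pos hf' 2) (hR.inner_nonneg_left f).1
  have hle : ‖f‖ ≤ μ * ‖R‖ * ‖f‖ := calc
    ‖f‖ = μ * ‖R f‖ := by conv_lhs => rw [← h, norm_smul, Complex.norm_of_nonneg hμ.le]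
    _ ≤ μ * ‖R‖ * ‖f‖ := by
      rw [mul_assoc]
      gcongr
      exact R.le_opNorm f
  have hμR : 1 ≤ μ * ‖R‖ := (le_mul_iff_one_le_left hf').1 hle
  exact (inv_le_iff_one_le_mul₀ (pos_of_mul_pos_right (one_pos.trans_le hμR) hμ.le)).2 hμR

end CompactPositive

section FirstEigenvalue

theorem mem_eigenvalues_iff {A : L2 →ₗ.[ℂ] L2} {lam : ℝ} :
    lam ∈ eigenvalues A ↔ ∃ f : L2, f ≠ 0 ∧ (f, (lam : ℂ) • f) ∈ A.graph := by
  constructor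
  · rintro ⟨f, hf, hAf⟩
    exact ⟨f, hf, hAf ▸ A.mem_graph f⟩
  · rintro ⟨f, hf, h⟩
    obtain ⟨f', rfl, hAf⟩ := A.mem_graph_iff.1 h
    exact ⟨f', hf, hAf⟩

theorem isFirstEigenvalue_inv_norm_sub {A : L2 →ₗ.[ℂ] L2} {c : ℝ}
    (hinj : ∀ f : L2, (f, (-c : ℂ) • f) ∈ A.graph → f = 0) {R : L2 →L[ℂ] L2}
    (hR : ∀ g, (R g, g + (-c : ℂ) • R g) ∈ A.graph) (hc : IsCompactOperator R)
    (hpos : R.IsPositive) (hne : R ≠ 0) : IsFirstEigenvalue A (‖R‖⁻¹ - c) := by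
  constructor
  · obtain ⟨v, hv, hRv⟩ := exists_apply_eq_norm_smul hc hpos hne
    have hne' : (‖R‖ : ℂ) ≠ 0 := Complex.ofReal_ne_zero.2 (norm_ne_zero_iff.2 hne)
    refine mem_eigenvalues_iff.2 ⟨v, hv, ?_⟩
    convert A.graph.smul_mem (‖R‖⁻¹ : ℂ) (hR v) using 1
    rw [hRv, Prod.smul_mk, smul_add, smul_comm _ (-c : ℂ), inv_smul_smul₀ hne']
    push_cast
    rw [sub_eq_add_neg, add_smul]
  · intro lam hlam
    obtain ⟨f, hf, hAf⟩ := mem_eigenvalues_iff.1 hlam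
    have hRf : ((lam + c : ℝ) : ℂ) • R f = f := by
      have h := apply_sub_smul_eq_of_mem hinj hR hAf
      rw [← sub_smul, map_smul, sub_neg_eq_add] at h
      exact_mod_cast h
    exact sub_le_iff_le_add.2 (inv_norm_le_of_smul_apply_eq hpos hf hRf)

end FirstEigenvalue

/-- The exponential wave `x ↦ e^{ikx}`; the test function of the variational argument and, for large
`k`, the leading part of the eigenfunctions. -/
def wave (k x : ℝ) : ℂ := Complex.exp (Complex.I * k * x)

section Wave

variable (k x : ℝ)

theorem hasDerivAt_wave : HasDerivAt (wave k) (Complex.I * k * wave k x) x :=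
  ((hasDerivAt_id x).ofReal_comp.const_mul (Complex.I * k)).cexp.congr_deriv <| by
    simp only [wave, id_eq, Complex.ofReal_one, mul_one, mul_comm]

theorem continuous_wave : Continuous (wave k) := by unfold wave; fun_prop

theorem norm_wave : ‖wave k x‖ = 1 := by
  rw [wave, mul_assoc, ← Complex.ofReal_mul, Complex.norm_exp_I_mul_ofReal]

theorem wave_zero_left : wave 0 x = 1 := by simp [wave]

theorem wave_zero_right : wave k 0 = 1 := by simp [wave]

theorem wave_one_right : wave k 1 = Complex.exp (Complex.I * k) := by simp [wave]

theorem wave_mul_wave (l : ℝ) : wave k x * wave l x = wave (k + l) x := by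
  rw [wave, wave, wave, ← Complex.exp_add, Complex.ofReal_add]
  ring_nf

theorem isC1_wave : IsC1 (wave k) (fun x => Complex.I * k * wave k x) :=
  ⟨fun x _ => (hasDerivAt_wave k x).hasDerivWithinAt,
    (continuous_const.mul (continuous_wave k)).continuousOn⟩

theorem memLp_wave : MemLp (wave k) 2 μ₀ :=
  .of_bound (continuous_wave k).aestronglyMeasurable 1 (ae_of_all _ fun x => (norm_wave k x).le)

end Wave

theorem energy_wave {q : ℝ → ℝ} (hq : IntervalIntegrable q volume 0 1) (τ : ℝ) :
    energy q 0 (wave τ) (fun x => Complex.I * τ * wave τ x) =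
      τ ^ 2 + ∫ x in (0 : ℝ)..1, q x := by
  simp only [energy_eq_add hq (isC1_wave τ), norm_mul, norm_wave, Complex.norm_I, one_mul, mul_one,
    Complex.norm_real, Real.norm_eq_abs, sq_abs, one_pow, intervalIntegral.integral_const,
    sub_zero, smul_eq_mul, add_zero]

section Variational

variable {q : ℝ → ℝ} {t c : ℝ}

theorem exists_isC1_of_mem_graph (hq : IntervalIntegrable q volume 0 1) {f g : L2}
    (h : (f, g + (-c : ℂ) • f) ∈ graph t q) :
    ∃ y u : ℝ → ℂ, IsC1 y u ∧ f =ᵐ[μ₀] y ∧ inner ℂ f g = energy q c y u ∧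
      ∀ y' u' : ℝ → ℂ, IsC1 y' u' → y' 1 = Complex.exp (Complex.I * t) * y' 0 →
        ∫ x in (0 : ℝ)..1, g x * conj (y' x) = energyInner q c y u y' u' := by
  obtain ⟨y, u, hyu, hfy⟩ := h
  have hs : HasSecondDeriv (Complex.exp (Complex.I * t)) y u
      (fun x => q x * y x - (g x - c * y x)) := by
    refine (solves_iff_hasSecondDeriv.1 hyu).congr_ae ?_
    filter_upwards [hfy, Lp.coeFn_add g ((-c : ℂ) • f), Lp.coeFn_smul (-c : ℂ) f] with x h₁ h₂ h₃
    rw [h₂, Pi.add_apply, h₃, Pi.smul_apply, smul_eq_mul, h₁]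
    ring
  have hweak := fun y' u' => hs.integral_mul_conj_eq_energyInner (y' := y') (u' := u') hq
    (Complex.norm_exp_I_mul_ofReal t) (intervalIntegrable_coeFn one_le_two g)
  refine ⟨y, u, hs.isC1, hfy, ?_, hweak⟩
  rw [inner_eq_integral_mul_conj hfy ae_eq_rfl, hweak y u hs.isC1 hs.apply_one, energyInner_self]

variable (hc : ∀ y u : ℝ → ℂ, IsC1 y u → ∫ x in (0 : ℝ)..1, ‖y x‖ ^ 2 ≤ energy q c y u)
include hc

theorem energy_nonneg {y u : ℝ → ℂ} (h : IsC1 y u) : 0 ≤ energy q c y u :=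
  (intervalIntegral.integral_nonneg zero_le_one fun _ _ => by positivity).trans (hc y u h)

theorem eq_zero_of_mem_graph (hq : IntervalIntegrable q volume 0 1) {f : L2}
    (h : (f, (-c : ℂ) • f) ∈ graph t q) : f = 0 := by
  obtain ⟨y, u, hyu, hfy, hinner, -⟩ :=
    exists_isC1_of_mem_graph (g := 0) hq (by rwa [zero_add])
  rw [inner_zero_right, eq_comm, Complex.ofReal_eq_zero] at hinner
  have hle := hc y u hyu
  rw [hinner, integral_norm_sq_eq_norm_sq hfy] at hle
  exact norm_eq_zero.1 (pow_eq_zero_iff two_ne_zero |>.1 (le_antisymm hle (sq_nonneg _)))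

theorem isPositive_of_mem_graph (hq : IntervalIntegrable q volume 0 1) {R : L2 →L[ℂ] L2}
    (hR : ∀ g, (R g, g + (-c : ℂ) • R g) ∈ graph t q) : R.IsPositive := by
  refine (ContinuousLinearMap.isPositive_iff_complex R).2 fun g => ?_
  obtain ⟨y, u, hyu, -, hinner, -⟩ := exists_isC1_of_mem_graph hq (hR g)
  rw [hinner]
  exact ⟨rfl, energy_nonneg hc hyu⟩

theorem norm_pow_four_le_inner_mul_energy (hq : IntervalIntegrable q volume 0 1)
    {R : L2 →L[ℂ] L2} (hR : ∀ g, (R g, g + (-c : ℂ) • R g) ∈ graph t q) {F : L2} {y' u' : ℝ → ℂ}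
    (hF : F =ᵐ[μ₀] y') (h' : IsC1 y' u') (h'₁ : y' 1 = Complex.exp (Complex.I * t) * y' 0) :
    ‖F‖ ^ 4 ≤ (inner ℂ (R F) F).re * energy q c y' u' := by
  obtain ⟨y, u, hyu, -, hinner, hweak⟩ := exists_isC1_of_mem_graph hq (hR F)
  have hre : (energyInner q c y u y' u').re = ‖F‖ ^ 2 := by
    rw [← hweak y' u' h' h'₁, ← inner_eq_integral_mul_conj hF ae_eq_rfl]
    exact inner_self_eq_norm_sq (𝕜 := ℂ) F
  rw [hinner, Complex.ofReal_re]
  convert sq_re_energyInner_le hq (fun _ _ => energy_nonneg hc) hyu h' using 1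
  rw [hre, ← pow_mul]

end Variational

theorem ae_eq_of_mem_graph_wave {q : ℝ → ℝ} {t τ : ℝ} {z : ℂ} {F : L2} (hF : F =ᵐ[μ₀] wave τ)
    (h : (F, z • F) ∈ graph t q) : ∀ᵐ x ∂μ₀, (q x : ℂ) = z - τ ^ 2 := by
  obtain ⟨y, u, hyu, hFy⟩ := h
  have hs := solves_iff_hasSecondDeriv.1 hyu
  have hy : EqOn y (wave τ) (Icc 0 1) :=
    Measure.eqOn_Icc_of_ae_eq volume zero_ne_one (hFy.symm.trans hF) hs.isC1.continuousOn
      (continuous_wave τ).continuousOn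
  have hu : ∀ x ∈ Icc (0 : ℝ) 1, u x = Complex.I * τ * wave τ x := fun x hx =>
    (uniqueDiffOn_Icc zero_lt_one x hx).eq_deriv _ (hs.hasDerivWithinAt x hx)
      ((hasDerivAt_wave τ x).hasDerivWithinAt.congr hy (hy hx))
  filter_upwards [hs.ae_hasDerivAt_deriv, hF, Lp.coeFn_smul z F, ae_mem_Ioo_zero_one]
    with x hux hFx hzF hx
  have hw := hux.unique (((hasDerivAt_wave τ x).const_mul (Complex.I * τ)).congr_of_eventuallyEq <|
    mem_of_superset (Icc_mem_nhds hx.1 hx.2) hu)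
  rw [hzF, Pi.smul_apply, hFx, hy (Ioo_subset_Icc_self hx), smul_eq_mul] at hw
  refine mul_right_cancel₀ (norm_ne_zero_iff.1 (by rw [norm_wave τ x]; exact one_ne_zero)) ?_
  linear_combination hw + τ ^ 2 * wave τ x * Complex.I_sq

/-- With `R` the resolvent at `-c` and `α = energy q c y u`, the assumption says `‖R‖ ≤ α⁻¹`, while
the Cauchy-Schwarz inequality for the energy gives `α⁻¹ ≤ ⟪R F, F⟫`: so `F` maximises the form of
`R`. -/
theorem mem_graph_of_energy_le_firstEigenvalue {q : ℝ → ℝ} (hq : IntervalIntegrable q volume 0 1)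
    {t : ℝ} {F : L2} {y u : ℝ → ℂ} (hFy : F =ᵐ[μ₀] y) (hF : ‖F‖ = 1) (hyu : IsC1 y u)
    (hy₁ : y 1 = Complex.exp (Complex.I * t) * y 0)
    (hfirst : ∀ lam, IsFirstEigenvalue (L t q) lam → energy q 0 y u ≤ lam) :
    (F, (energy q 0 y u : ℂ) • F) ∈ graph t q := by
  obtain ⟨c, hc⟩ := exists_integral_norm_sq_le_energy hq
  have hinj : ∀ f : L2, (f, (-c : ℂ) • f) ∈ graph t q → f = 0 := fun f =>
    eq_zero_of_mem_graph hc hq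
  obtain ⟨R, hRc, hR⟩ := exists_resolvent hq hinj
  have hpos := isPositive_of_mem_graph hc hq hR
  set α := energy q c y u
  have hα : α = energy q 0 y u + c := by
    rw [← mul_one c, ← one_pow 2, ← hF, ← integral_norm_sq_eq_norm_sq hFy]
    simp only [α, energy_eq_add hq hyu, zero_mul, add_zero]
  have hCS : 1 ≤ (inner ℂ (R F) F).re * α := by
    simpa only [hF, one_pow] using norm_pow_four_le_inner_mul_energy hc hq hR hFy hyu hy₁
  have hα₀ : 0 < α := pos_of_mul_pos_right (one_pos.trans_le hCS) (hpos.inner_nonneg_left F).1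
  have hR₀ : R ≠ 0 := by
    rintro rfl
    norm_num at hCS
  have hRα : ‖R‖ ≤ α⁻¹ := by
    rw [← L_graph] at hinj hR
    have := hfirst _ (isFirstEigenvalue_inv_norm_sub hinj hR hRc hpos hR₀)
    rw [le_inv_comm₀ (norm_pos_iff.2 hR₀) hα₀]
    linarith
  convert (graph t q).smul_mem (α : ℂ) (hR F) using 1
  rw [apply_eq_inv_smul_of_norm_le hα₀ hF hRα hCS, Prod.smul_mk, smul_add, smul_comm _ (-c : ℂ),
    smul_inv_smul₀ (Complex.ofReal_ne_zero.2 hα₀.ne'), hα, Complex.ofReal_add]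
  congr 1
  module

theorem ae_eq_integral_of_isFirstEigenvalue {q : ℝ → ℝ} (hq : IntervalIntegrable q volume 0 1)
    {t τ : ℝ} (hτ : Complex.exp (Complex.I * τ) = Complex.exp (Complex.I * t))
    (hfirst : ∀ lam, IsFirstEigenvalue (L t q) lam → τ ^ 2 + ∫ x in (0 : ℝ)..1, q x ≤ lam) :
    ∀ᵐ x ∂μ₀, q x = ∫ s in (0 : ℝ)..1, q s := by
  set F : L2 := (memLp_wave τ).toLp
  have hFw : F =ᵐ[μ₀] wave τ := (memLp_wave τ).coeFn_toLp
  have hF : ‖F‖ = 1 := by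
    rw [← sq_eq_sq₀ (norm_nonneg F) zero_le_one, ← integral_norm_sq_eq_norm_sq hFw]
    simp only [norm_wave, one_pow, intervalIntegral.integral_const, sub_zero, one_smul]
  have hmem := mem_graph_of_energy_le_firstEigenvalue (t := t) hq hFw hF (isC1_wave τ)
    (by rw [wave_one_right, wave_zero_right, hτ, mul_one]) (by rwa [energy_wave hq])
  filter_upwards [ae_eq_of_mem_graph_wave hFw hmem] with x hx
  have hqx : q x = energy q 0 (wave τ) (fun x => Complex.I * τ * wave τ x) - τ ^ 2 := by
    exact_mod_cast hx
  rw [hqx, energy_wave hq, add_sub_cancel_left]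

/-- The Fourier integral of `q` over `[0,1]` at the frequency `-k / (2π)`. -/
def waveCoeff (q : ℝ → ℝ) (k : ℝ) : ℂ := ∫ x in (0 : ℝ)..1, wave k x * q x

theorem waveCoeff_zero (q : ℝ → ℝ) : waveCoeff q 0 = ((∫ x in (0 : ℝ)..1, q x : ℝ) : ℂ) := by
  simp only [waveCoeff, wave_zero_left, one_mul, intervalIntegral.integral_ofReal]

theorem tendsto_waveCoeff (q : ℝ → ℝ) : Tendsto (waveCoeff q) (cocompact ℝ) (𝓝 0) := by
  have hscale : Tendsto (fun k : ℝ => k * (-(2 * Real.pi)⁻¹)) (cocompact ℝ) (cocompact ℝ) :=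
    tendsto_cocompact_mul_right₀ (by simp [Real.pi_ne_zero])
  refine ((Real.tendsto_integral_exp_smul_cocompact
    ((Ioc (0 : ℝ) 1).indicator fun x => (q x : ℂ))).comp hscale).congr fun k => ?_
  rw [waveCoeff, intervalIntegral.integral_of_le zero_le_one,
    ← integral_indicator measurableSet_Ioc]
  refine integral_congr_ae (ae_of_all _ fun x => ?_)
  by_cases hx : x ∈ Ioc (0 : ℝ) 1
  · simp only [indicator_of_mem hx, Circle.smul_def, Real.fourierChar_apply, smul_eq_mul, wave]
    have := Complex.ofReal_ne_zero.2 Real.pi_ne_zero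
    push_cast
    field_simp
  · simp only [indicator_of_notMem hx, smul_zero]

theorem norm_integral_mul_le {q : ℝ → ℝ} (hq : IntervalIntegrable q volume 0 1) {f : ℝ → ℂ} {C : ℝ}
    (hf : ∀ x ∈ Icc (0 : ℝ) 1, ‖f x‖ ≤ C) {x : ℝ} (hx : x ∈ Icc (0 : ℝ) 1) :
    ‖∫ s in (0 : ℝ)..x, f s * q s‖ ≤ C * ∫ s in (0 : ℝ)..1, |q s| := by
  have hC : 0 ≤ C := (norm_nonneg _).trans (hf x hx)
  have hi : IntervalIntegrable (fun s => C * |q s|) volume 0 1 := hq.norm.const_mul C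
  rw [← intervalIntegral.integral_const_mul]
  calc ‖∫ s in (0 : ℝ)..x, f s * q s‖ ≤ ∫ s in (0 : ℝ)..x, C * |q s| := by
        refine intervalIntegral.norm_integral_le_of_norm_le hx.1 (ae_of_all _ fun s hs => ?_)
          (hi.mono_set (uIcc_zero_subset hx))
        rw [norm_mul, Complex.norm_real, Real.norm_eq_abs]
        exact mul_le_mul_of_nonneg_right (hf s ⟨hs.1.le, hs.2.trans hx.2⟩) (abs_nonneg _)
    _ ≤ ∫ s in (0 : ℝ)..1, C * |q s| :=
        intervalIntegral.integral_mono_interval le_rfl hx.1 hx.2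
          (ae_of_all _ fun s => mul_nonneg hC (abs_nonneg _)) hi

/-- The amplitude of the wave `e^{-ilx}` in the solution of `-y'' = l² y` with the initial values
`y 0` and `u 0`, times `-2il`. -/
def amplitude (y u : ℝ → ℂ) (l : ℝ) : ℂ := u 0 - Complex.I * l * y 0

namespace HasSecondDeriv

variable {q : ℝ → ℝ} {ω : ℂ} {l C : ℝ} {y u : ℝ → ℂ}
  (h : HasSecondDeriv ω y u (fun x => q x * y x - (l : ℂ) ^ 2 * y x))
include h

theorem neg_frequency :
    HasSecondDeriv ω y u (fun x => q x * y x - ((-l : ℝ) : ℂ) ^ 2 * y x) := by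
  simpa only [Complex.ofReal_neg, neg_sq] using h

variable (hq : IntervalIntegrable q volume 0 1)
include hq

/-- Variation of constants: `e^{ilx}` is an integrating factor. -/
theorem wave_mul_sub_eq {x : ℝ} (hx : x ∈ Icc (0 : ℝ) 1) :
    wave l x * (u x - Complex.I * l * y x) =
      amplitude y u l + ∫ s in (0 : ℝ)..x, wave l s * y s * q s := by
  have hint : IntervalIntegrable (fun s => wave l s * y s * q s) volume 0 1 :=
    (intervalIntegrable_ofReal hq).continuousOn_mul
      (uIcc_zero_one ▸ (continuous_wave l).continuousOn.mul h.isC1.continuousOn)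
  have hderiv : ∀ᵐ x, x ∈ uIcc (0 : ℝ) 1 → HasDerivAt
      (fun x => wave l x * (u x - Complex.I * l * y x)) (wave l x * y x * q x) x := by
    rw [uIcc_zero_one, ← ae_restrict_iff' measurableSet_Icc]
    filter_upwards [h.ae_hasDerivAt_deriv, h.isC1.ae_hasDerivAt] with x hu hy
    refine ((hasDerivAt_wave l x).mul (hu.fun_sub (hy.const_mul _))).congr_deriv ?_
    linear_combination -(l : ℂ) ^ 2 * wave l x * y x * Complex.I_sq
  have hac := (isC1_wave l).absolutelyContinuousOnInterval.fun_smul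
    (h.absolutelyContinuousOnInterval_deriv.fun_sub
      (h.isC1.const_mul (Complex.I * l)).absolutelyContinuousOnInterval)
  simpa only [smul_eq_mul, wave_zero_right, one_mul, amplitude] using
    eq_add_integral_of_absolutelyContinuousOnInterval hac hint hderiv x (uIcc_zero_one ▸ hx)

theorem integral_wave_mul_eq :
    ∫ s in (0 : ℝ)..1, wave l s * y s * q s = (wave l 1 * ω - 1) * amplitude y u l := by
  have h₁ := h.wave_mul_sub_eq hq (right_mem_Icc.2 zero_le_one)
  rw [h.apply_one, h.deriv_apply_one] at h₁
  rw [amplitude] at h₁ ⊢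
  linear_combination -h₁

variable (hC : ∀ x ∈ Icc (0 : ℝ) 1, ‖y x‖ ≤ C)
include hC

theorem norm_two_mul_sub_le {x : ℝ} (hx : x ∈ Icc (0 : ℝ) 1) :
    ‖2 * Complex.I * l * y x - (wave l x * amplitude y u (-l) - wave (-l) x * amplitude y u l)‖ ≤
      2 * C * ∫ s in (0 : ℝ)..1, |q s| := by
  have hbound (k : ℝ) : ‖∫ s in (0 : ℝ)..x, wave k s * y s * q s‖ ≤
      C * ∫ s in (0 : ℝ)..1, |q s| :=
    norm_integral_mul_le hq (fun s hs => by rw [norm_mul, norm_wave, one_mul]; exact hC s hs) hx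
  have hinv : wave l x * wave (-l) x = 1 := by rw [wave_mul_wave, add_neg_cancel, wave_zero_left]
  have hpos := h.wave_mul_sub_eq hq hx
  have hneg := h.neg_frequency.wave_mul_sub_eq hq hx
  rw [Complex.ofReal_neg] at hneg
  have heq : 2 * Complex.I * l * y x -
      (wave l x * amplitude y u (-l) - wave (-l) x * amplitude y u l) =
        wave l x * (∫ s in (0 : ℝ)..x, wave (-l) s * y s * q s) -
          wave (-l) x * ∫ s in (0 : ℝ)..x, wave l s * y s * q s := by
    linear_combination
      wave l x * hneg - wave (-l) x * hpos - 2 * Complex.I * l * y x * hinv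
  rw [heq, two_mul C, add_mul]
  refine (norm_sub_le _ _).trans (add_le_add ?_ ?_) <;>
    rw [norm_mul, norm_wave, one_mul] <;> exact hbound _

theorem norm_mul_amplitude_sub_le :
    ‖(2 * Complex.I * l * (wave l 1 * ω - 1) + waveCoeff q 0) * amplitude y u l -
        waveCoeff q (2 * l) * amplitude y u (-l)‖ ≤ 2 * C * (∫ s in (0 : ℝ)..1, |q s|) ^ 2 := by
  have hwave (k : ℝ) (a : ℂ) : IntervalIntegrable (fun s => a * (wave k s * q s)) volume 0 1 :=
    ((intervalIntegrable_ofReal hq).continuousOn_mul (continuous_wave k).continuousOn).const_mul a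
  have hy : IntervalIntegrable (fun s => 2 * Complex.I * l * (wave l s * y s * q s)) volume 0 1 :=
    ((intervalIntegrable_ofReal hq).continuousOn_mul (uIcc_zero_one ▸
      (continuous_wave l).continuousOn.mul h.isC1.continuousOn)).const_mul _
  have hpointwise (s : ℝ) : wave l s * (2 * Complex.I * l * y s -
      (wave l s * amplitude y u (-l) - wave (-l) s * amplitude y u l)) * q s =
        2 * Complex.I * l * (wave l s * y s * q s) -
          (amplitude y u (-l) * (wave (2 * l) s * q s) - amplitude y u l * (wave 0 s * q s)) := by
    rw [two_mul l, ← add_neg_cancel l, ← wave_mul_wave, ← wave_mul_wave]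
    ring
  have herror := norm_integral_mul_le hq
    (f := fun s => wave l s * (2 * Complex.I * l * y s -
      (wave l s * amplitude y u (-l) - wave (-l) s * amplitude y u l)))
    (fun s hs => by
      rw [norm_mul, norm_wave, one_mul]
      exact h.norm_two_mul_sub_le hq hC hs)
    (right_mem_Icc.2 zero_le_one)
  simp only [hpointwise] at herror
  rw [intervalIntegral.integral_sub hy ((hwave _ _).sub (hwave _ _)),
    intervalIntegral.integral_sub (hwave _ _) (hwave _ _), intervalIntegral.integral_const_mul,
    intervalIntegral.integral_const_mul, intervalIntegral.integral_const_mul,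
    h.integral_wave_mul_eq hq, ← waveCoeff, ← waveCoeff, mul_assoc (2 * C), ← sq] at herror
  convert herror using 2
  ring

theorem mul_norm_le_norm_amplitude_add {x : ℝ} (hx : x ∈ Icc (0 : ℝ) 1) :
    2 * |l| * ‖y x‖ ≤
      ‖amplitude y u (-l)‖ + ‖amplitude y u l‖ + 2 * C * ∫ s in (0 : ℝ)..1, |q s| := by
  have hsub := norm_sub_norm_le (2 * Complex.I * l * y x)
    (wave l x * amplitude y u (-l) - wave (-l) x * amplitude y u l)
  have hadd := norm_sub_le (wave l x * amplitude y u (-l)) (wave (-l) x * amplitude y u l)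
  have herror := h.norm_two_mul_sub_le hq hC hx
  simp only [norm_mul, norm_wave, one_mul, Complex.norm_I, mul_one, Complex.norm_real,
    Complex.norm_two, Real.norm_eq_abs] at hsub hadd
  linarith

end HasSecondDeriv

theorem norm_le_add_div_of_norm_mul_sub_le {a b c d : ℂ} {M r : ℝ} (hr : 0 < r) (hra : r ≤ ‖a‖)
    (hba : ‖b‖ ≤ ‖a‖) (h : ‖c * a - d * b‖ ≤ M) : ‖c‖ ≤ ‖d‖ + M / r := by
  have ha : 0 < ‖a‖ := hr.trans_le hra
  have hsub := (norm_sub_norm_le (c * a) (d * b)).trans h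
  rw [norm_mul, norm_mul] at hsub
  have hdb := mul_le_mul_of_nonneg_left hba (norm_nonneg d)
  calc ‖c‖ ≤ (‖d‖ * ‖a‖ + M) / ‖a‖ := (le_div_iff₀ ha).2 (by linarith)
    _ = ‖d‖ + M / ‖a‖ := by rw [add_div, mul_div_cancel_right₀ _ ha.ne']
    _ ≤ ‖d‖ + M / r := by gcongr; exact (norm_nonneg _).trans h

theorem HasSecondDeriv.exists_norm_le {q : ℝ → ℝ} (hq : IntervalIntegrable q volume 0 1)
    {ω : ℂ} {k : ℝ} {y u : ℝ → ℂ}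
    (h : HasSecondDeriv ω y u (fun x => q x * y x - (k : ℂ) ^ 2 * y x))
    (hy : ∃ x ∈ Icc (0 : ℝ) 1, y x ≠ 0) (hk : ∫ s in (0 : ℝ)..1, |q s| < |k|) :
    ∃ l, (l = k ∨ l = -k) ∧ ‖2 * Complex.I * l * (wave l 1 * ω - 1) + waveCoeff q 0‖ ≤
      ‖waveCoeff q (2 * l)‖ +
        2 * (∫ s in (0 : ℝ)..1, |q s|) ^ 2 / (|l| - ∫ s in (0 : ℝ)..1, |q s|) := by
  wlog hle : ‖amplitude y u (-k)‖ ≤ ‖amplitude y u k‖ generalizing k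
  · obtain ⟨l, hl, hbound⟩ := this h.neg_frequency (by rwa [abs_neg])
      (by rw [neg_neg]; exact (not_le.1 hle).le)
    exact ⟨l, by rwa [neg_neg, or_comm] at hl, hbound⟩
  refine ⟨k, .inl rfl, ?_⟩
  obtain ⟨x₀, hx₀, hmax⟩ := isCompact_Icc.exists_isMaxOn (nonempty_Icc.2 zero_le_one)
    h.isC1.continuousOn.norm
  obtain ⟨x₁, hx₁, hne⟩ := hy
  have hy₀ : 0 < ‖y x₀‖ := (norm_pos_iff.2 hne).trans_le (hmax hx₁)
  have hlarge := h.mul_norm_le_norm_amplitude_add hq (fun x hx => hmax hx) hx₀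
  convert norm_le_add_div_of_norm_mul_sub_le (mul_pos hy₀ (sub_pos.2 hk)) (by linarith) hle
    (h.norm_mul_amplitude_sub_le hq fun x hx => hmax hx) using 2
  rw [mul_right_comm, mul_comm (_ * _) ‖y x₀‖, mul_div_mul_left _ _ hy₀.ne']

theorem exists_hasSecondDeriv_of_mem_spectrum {q : ℝ → ℝ} (hq : IntervalIntegrable q volume 0 1)
    {t : ℝ} {z : ℂ} (hz : z ∈ spectrum (L t q)) :
    ∃ y u : ℝ → ℂ, (∃ x ∈ Icc (0 : ℝ) 1, y x ≠ 0) ∧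
      HasSecondDeriv (Complex.exp (Complex.I * t)) y u (fun x => q x * y x - z * y x) := by
  obtain ⟨f, hf, y, u, hyu, hfy⟩ := exists_mem_graph_of_mem_spectrum hq hz
  refine ⟨y, u, ?_, (solves_iff_hasSecondDeriv.1 hyu).congr_ae ?_⟩
  · contrapose! hf
    rw [Lp.eq_zero_iff_ae_eq_zero]
    exact hfy.trans (ae_restrict_of_forall_mem measurableSet_Icc hf)
  · filter_upwards [hfy, Lp.coeFn_smul z f] with x hfx hzf
    rw [hzf, Pi.smul_apply, smul_eq_mul, hfx]

theorem eventually_norm_le_norm_mul_add (c d : ℂ) : ∀ᶠ k : ℝ in atTop, ‖d‖ ≤ ‖c * k + d‖ := by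
  rcases eq_or_ne c 0 with rfl | hc
  · simp
  filter_upwards [eventually_ge_atTop (2 * ‖d‖ / ‖c‖)] with k hk
  have hck : 2 * ‖d‖ ≤ ‖c * k‖ := by
    rw [norm_mul, Complex.norm_real, Real.norm_eq_abs]
    exact (div_le_iff₀' (norm_pos_iff.2 hc)).1 (hk.trans (le_abs_self k))
  linarith [norm_le_add_norm_add (c * k) d]

theorem integral_eq_zero_of_frequently_mem_spectrum {q : ℝ → ℝ}
    (hq : IntervalIntegrable q volume 0 1) {t : ℝ}
    (hspec : ∃ᶠ k : ℝ in atTop, Complex.exp (Complex.I * k) * Complex.exp (Complex.I * t) = 1 ∧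
      ((k ^ 2 : ℝ) : ℂ) ∈ spectrum (L t q)) :
    ∫ x in (0 : ℝ)..1, q x = 0 := by
  set N := ∫ s in (0 : ℝ)..1, |q s|
  set r : ℝ → ℝ := fun l => ‖waveCoeff q (2 * l)‖ + 2 * N ^ 2 / (|l| - N)
  have hr : Tendsto r (cocompact ℝ) (𝓝 0) := by
    have hcoeff : Tendsto (fun l : ℝ => ‖waveCoeff q (2 * l)‖) (cocompact ℝ) (𝓝 0) :=
      tendsto_zero_iff_norm_tendsto_zero.1
        ((tendsto_waveCoeff q).comp (tendsto_cocompact_mul_left₀ two_ne_zero))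
    have herror : Tendsto (fun l : ℝ => 2 * N ^ 2 / (|l| - N)) (cocompact ℝ) (𝓝 0) :=
      (tendsto_atTop_add_const_right _ (-N) tendsto_norm_cocompact_atTop).const_div_atTop _
    simpa only [add_zero] using hcoeff.add herror
  have hmax : Tendsto (fun k => max (r k) (r (-k))) atTop (𝓝 0) := by
    rw [← max_self (0 : ℝ)]
    exact (hr.mono_left atTop_le_cocompact).max
      (hr.comp (tendsto_neg_atTop_atBot.mono_right atBot_le_cocompact))
  suffices hle : ∃ᶠ k in atTop, ‖waveCoeff q 0‖ ≤ max (r k) (r (-k)) by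
    rw [← Complex.ofReal_eq_zero, ← waveCoeff_zero, ← norm_le_zero_iff]
    exact ge_of_tendsto_of_frequently hmax hle
  refine (hspec.and_eventually ((eventually_gt_atTop N).and
    (eventually_norm_le_norm_mul_add (-2 * Complex.I * (Complex.exp (Complex.I * t) ^ 2 - 1))
      (waveCoeff q 0)))).mono ?_
  rintro k ⟨⟨hkE, hk⟩, hNk, hQ⟩
  obtain ⟨y, u, hy, h⟩ := exists_hasSecondDeriv_of_mem_spectrum hq hk
  rw [Complex.ofReal_pow] at h
  obtain ⟨l, rfl | rfl, hl⟩ := h.exists_norm_le hq hy (hNk.trans_le (le_abs_self k))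
  · rw [wave_one_right, hkE, sub_self, mul_zero, zero_add] at hl
    exact hl.trans (le_max_left _ _)
  · have hE : wave (-k) 1 = Complex.exp (Complex.I * t) := by
      rw [wave_one_right, Complex.ofReal_neg, mul_neg, Complex.exp_neg]
      exact inv_eq_of_mul_eq_one_right hkE
    refine (hQ.trans (le_of_eq_of_le ?_ hl)).trans (le_max_right _ _)
    rw [hE, Complex.ofReal_neg]
    ring_nf

theorem exp_I_mul_two_mul_pi_sub (t : ℝ) (n : ℕ) :
    Complex.exp (Complex.I * (2 * n * Real.pi - t : ℝ)) * Complex.exp (Complex.I * t) = 1 := by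
  rw [← Complex.exp_add, Complex.exp_eq_one_iff]
  exact ⟨n, by push_cast; ring⟩

theorem exists_sq_eq_min_and_exp_eq (t : ℝ) :
    ∃ τ : ℝ, τ ^ 2 = min (t ^ 2) ((2 * Real.pi - t) ^ 2) ∧
      Complex.exp (Complex.I * τ) = Complex.exp (Complex.I * t) := by
  rcases le_total (t ^ 2) ((2 * Real.pi - t) ^ 2) with h | h
  · exact ⟨t, (min_eq_left h).symm, rfl⟩
  · refine ⟨t - 2 * Real.pi, by rw [min_eq_right h, sub_sq_comm], ?_⟩
    exact Complex.exp_eq_exp_iff_exists_int.2 ⟨-1, by push_cast; ring⟩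

end UnitInterval

end QuasiPeriodic

end

theorem theorem1_general (q : ℝ → ℝ) (hq : IntegrableOn q (Icc (0 : ℝ) 1)) (t τ : ℝ)
    (hτ : Complex.exp (Complex.I * τ) = Complex.exp (Complex.I * t))
    (hfirst : ∀ lam : ℝ, QuasiPeriodic.IsFirstEigenvalue (QuasiPeriodic.L t q) lam → τ ^ 2 ≤ lam)
    (hspec : ∃ᶠ n : ℕ in Filter.atTop,
      (((2 * n * Real.pi - t) ^ 2 : ℝ) : ℂ) ∈ QuasiPeriodic.spectrum (QuasiPeriodic.L t q)) :
    ∀ᵐ x ∂(volume.restrict (Icc (0 : ℝ) 1)), q x = 0 := by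
  have hq' : IntervalIntegrable q volume 0 1 := QuasiPeriodic.intervalIntegrable_zero_one_iff.2 hq
  have hfreq : Filter.Tendsto (fun n : ℕ => 2 * n * Real.pi - t) Filter.atTop Filter.atTop :=
    Filter.tendsto_atTop_add_const_right _ (-t)
      ((tendsto_natCast_atTop_atTop.const_mul_atTop two_pos).atTop_mul_const Real.pi_pos)
  have hmean : ∫ x in (0 : ℝ)..1, q x = 0 :=
    QuasiPeriodic.integral_eq_zero_of_frequently_mem_spectrum hq' <| hfreq.frequently <|
      hspec.mono fun n hn => ⟨QuasiPeriodic.exp_I_mul_two_mul_pi_sub t n, hn⟩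
  simpa only [hmean] using QuasiPeriodic.ae_eq_integral_of_isFirstEigenvalue hq' hτ
    fun lam hlam => by simpa only [hmean, add_zero] using hfirst lam hlam

theorem theorem1 (q : ℝ → ℝ) (hq : IntegrableOn q (Icc (0 : ℝ) 1))
    (t : ℝ) (ht : t ∈ Ico 0 (2 * Real.pi))
    (hfirst : ∀ lam : ℝ, QuasiPeriodic.IsFirstEigenvalue (QuasiPeriodic.L t q) lam →
      min (t ^ 2) ((2 * Real.pi - t) ^ 2) ≤ lam)
    (hspec : ∀ n : ℕ, 1 ≤ n →
      (((2 * n * Real.pi - t) ^ 2 : ℝ) : ℂ) ∈ QuasiPeriodic.spectrum (QuasiPeriodic.L t q)) :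
    ∀ᵐ x ∂(volume.restrict (Icc (0 : ℝ) 1)), q x = 0 := by
  obtain ⟨τ, hτ, hexp⟩ := QuasiPeriodic.exists_sq_eq_min_and_exp_eq t
  exact theorem1_general q hq t τ hexp (by rwa [hτ])
    ((Filter.eventually_ge_atTop 1).mono hspec).frequently
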